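/- Let $E$ be a reflexive real Banach space and let $M$ be a regular Hausdorff $C^1$ manifold (without boundary) modelled on $E$; the case $M=E$ is included. For $\psi:M\to\mathbb R$ and $q\in M$, the Fréchet subdifferential $\partial_F\psi(q)\subset T_q^*M$ is the set of all differentials $dg_q$ of $C^1$ functions $g:M\to\mathbb R$ such that $\psi-g$ has a local minimum at $q$. The limiting subdifferential $\partial_L\psi(q)\subset T_q^*M$ is the set of all $\zeta$ for which there are $q_k\to q$ with $\psi(q_k)\to\psi(q)$ and $\zeta_k\in\partial_F\psi(q_k)$ with $\zeta_k\rightharpoonup\zeta$, where weak convergence means weak convergence in $E^*$ of the coordinate expressions of the $\zeta_k$ in charts around $q$. Let $\ell:M\to\mathbb R$ be locally Lipschitz (that is, locally Lipschitz in local coordinates), let $q\in M$, and let $V\subset T_qM$ be closed, bounded and convex. For $v\in V$ and a coordinate chart $\varphi$ around $q$, the set-constrained weak lower Dini derivative of $\ell$ at $q$ in direction $v$ is $$D^w_V\ell(q;v):=\inf\ \lim_{n\to\infty}\frac{\ell\bigl(\varphi^{-1}(\varphi(q)+\lambda_n\,d\varphi_q v_n)\bigr)-\ell(q)}{\lambda_n},$$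 the infimum being over all sequences $v_n\in V$ that converge weakly to $v$ and all $\lambda_n>0$ with $\lambda_n\to0$ for which the limit exists in $[-\infty,\infty]$. Then, for every chart $\varphi$ around $q$ used to compute $D^w_V\ell(q;\cdot)$ and every $r\in\mathbb R$ with $D^w_V\ell(q;v)\ge r$ for all $v\in V$, there exists $\zeta\in\partial_L\ell(q)$ such that $\langle\zeta,v\rangle\ge r$ for all $v\in V$. -/

import Mathlib

open Filter Topology
open scoped Manifold ContDiff

noncomputable section

/-- A real normed space is reflexive if the canonical isometry into its bidual is onto. -/
def IsReflexiveSpace (E : Type*) [NormedAddCommGroup E] [NormedSpace ℝ E] : Prop :=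
  Function.Surjective (NormedSpace.inclusionInDoubleDual ℝ E)

section Manifold

variable {E : Type*} [NormedAddCommGroup E] [NormedSpace ℝ E]
  {M : Type*} [TopologicalSpace M] [ChartedSpace E M]

/-- `φ` is a (`C¹`-compatible) coordinate chart of `M` whose domain contains `q`. -/
def IsChartAround (φ : OpenPartialHomeomorph M E) (q : M) : Prop :=
  φ ∈ IsManifold.maximalAtlas 𝓘(ℝ, E) 1 M ∧ q ∈ φ.source

/-- `ℓ` is locally Lipschitz on the manifold `M`: every point has a chart in which `ℓ` is
Lipschitz, of some rank, near that point. -/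
def IsLocallyLipschitzOnManifold (ℓ : M → ℝ) : Prop :=
  ∀ p : M, ∃ φ : OpenPartialHomeomorph M E, IsChartAround φ p ∧
    ∃ K : NNReal, ∃ U ∈ 𝓝 (φ p), LipschitzOnWith K (ℓ ∘ φ.symm) U

/-- The Fréchet subdifferential of `ψ` at `q`: the differentials `dg_q` of the
`C¹` functions `g` on `M` such that `ψ - g` has a local minimum at `q`. -/
def frechetSubdifferential (ψ : M → ℝ) (q : M) : Set (TangentSpace 𝓘(ℝ, E) q →L[ℝ] ℝ) :=
  {ζ | ∃ g : M → ℝ, ContMDiff 𝓘(ℝ, E) 𝓘(ℝ, ℝ) 1 g ∧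
    IsLocalMin (fun p => ψ p - g p) q ∧ mvfderiv 𝓘(ℝ, E) g q = ζ}

/-- Weak convergence `ζ_k ⇀ ζ` of covectors `ζ_k ∈ T*_{q_k}M` to `ζ ∈ T*_qM` (where `q_k → q`):
in every chart `φ` around `q`, the coordinate expressions `ζ_k ∘ (dφ_{q_k})⁻¹` converge to
`ζ ∘ (dφ_q)⁻¹` pointwise on `E`, i.e. weak-* in the dual of `E`, which for reflexive `E` is weak
convergence. (As `q_k → q`, all but finitely many `q_k` are in the domain of `φ`.) -/
def CovectorsTendstoWeakly (p : ℕ → M) (ζs : ∀ k, TangentSpace 𝓘(ℝ, E) (p k) →L[ℝ] ℝ)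
    (q : M) (ζ : TangentSpace 𝓘(ℝ, E) q →L[ℝ] ℝ) : Prop :=
  ∀ φ : OpenPartialHomeomorph M E, IsChartAround φ q → ∀ w : E,
    Tendsto (fun k => ζs k ((mvfderiv 𝓘(ℝ, E) φ (p k)).inverse w)) atTop
      (𝓝 (ζ ((mvfderiv 𝓘(ℝ, E) φ q).inverse w)))

/-- The limiting subdifferential of `ψ` at `q`. -/
def limitingSubdifferential (ψ : M → ℝ) (q : M) : Set (TangentSpace 𝓘(ℝ, E) q →L[ℝ] ℝ) :=
  {ζ | ∃ (p : ℕ → M) (ζs : ∀ k, TangentSpace 𝓘(ℝ, E) (p k) →L[ℝ] ℝ),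
    Tendsto p atTop (𝓝 q) ∧ Tendsto (fun k => ψ (p k)) atTop (𝓝 (ψ q)) ∧
    (∀ k, ζs k ∈ frechetSubdifferential ψ (p k)) ∧ CovectorsTendstoWeakly p ζs q ζ}

/-- The set-constrained weak lower Dini derivative `D^w_V ℓ(q; v)`, computed in the chart `φ`:
the infimum of the limits (in the extended reals, whenever they exist) of the difference quotients
`(ℓ(φ⁻¹(φ(q) + λ_n dφ_q v_n)) - ℓ(q)) / λ_n` over sequences `v_n ∈ V` that converge weakly to `v`
and `λ_n ↓ 0`. -/
def weakLowerDini (φ : OpenPartialHomeomorph M E) (ℓ : M → ℝ) (q : M)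
    (V : Set (TangentSpace 𝓘(ℝ, E) q)) (v : TangentSpace 𝓘(ℝ, E) q) : EReal :=
  sInf {L : EReal | ∃ (vs : ℕ → TangentSpace 𝓘(ℝ, E) q) (t : ℕ → ℝ),
    (∀ n, vs n ∈ V) ∧
    (∀ ξ : TangentSpace 𝓘(ℝ, E) q →L[ℝ] ℝ, Tendsto (fun n => ξ (vs n)) atTop (𝓝 (ξ v))) ∧
    (∀ n, 0 < t n) ∧ Tendsto t atTop (𝓝 0) ∧
    Tendsto (fun n => (((ℓ (φ.symm (φ q + t n • mvfderiv 𝓘(ℝ, E) φ q (vs n)))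
      - ℓ q) / t n : ℝ) : EReal)) atTop (𝓝 L)}

end Manifold

end

section Hull

variable {E : Type*} [NormedAddCommGroup E] [NormedSpace ℝ E]

/-- A functional of norm at most one that attains the norm of `x`, and `0` for `x = 0`. -/
noncomputable def normingFunctional (x : E) : StrongDual ℝ E :=
  open Classical in if x = 0 then 0 else (exists_dual_vector'' ℝ x).choose

/-- A vector of norm at most one at which `f` attains its norm, if there is one. -/
noncomputable def attainingVector (f : StrongDual ℝ E) : E :=
  open Classical in
  if h : f ≠ 0 ∧ ∃ x, ‖x‖ ≤ 1 ∧ f x = ‖f‖ then h.2.choose else 0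

theorem normingFunctional_zero : normingFunctional (0 : E) = 0 := by
  simp [normingFunctional]

theorem norm_normingFunctional_le (x : E) : ‖normingFunctional x‖ ≤ 1 := by
  unfold normingFunctional
  split_ifs
  · simp
  · exact (exists_dual_vector'' ℝ x).choose_spec.1

theorem normingFunctional_apply (x : E) : normingFunctional x x = ‖x‖ := by
  unfold normingFunctional
  split_ifs with h
  · simp [h]
  · exact (exists_dual_vector'' ℝ x).choose_spec.2

theorem attainingVector_zero : attainingVector (0 : StrongDual ℝ E) = 0 := by
  simp [attainingVector]

theorem IsReflexiveSpace.exists_attains (hE : IsReflexiveSpace E) (f : StrongDual ℝ E) :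
    ∃ x, ‖x‖ ≤ 1 ∧ f x = ‖f‖ := by
  obtain ⟨g, hg, hgf⟩ := exists_dual_vector'' ℝ f
  obtain ⟨x, rfl⟩ := hE g
  refine ⟨x, ?_, by simpa using hgf⟩
  have := (NormedSpace.inclusionInDoubleDualLi ℝ (E := E)).norm_map x
  rw [← this]
  exact hg

theorem norm_attainingVector_le (f : StrongDual ℝ E) : ‖attainingVector f‖ ≤ 1 := by
  unfold attainingVector
  split_ifs with h
  · exact h.2.choose_spec.1
  · simp

theorem IsReflexiveSpace.apply_attainingVector (hE : IsReflexiveSpace E) (f : StrongDual ℝ E) :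
    f (attainingVector f) = ‖f‖ := by
  by_cases hf : f = 0
  · simp [hf]
  · have h : f ≠ 0 ∧ ∃ x, ‖x‖ ≤ 1 ∧ f x = ‖f‖ := ⟨hf, hE.exists_attains f⟩
    unfold attainingVector
    rw [dif_pos h]
    exact h.2.choose_spec.2

/-- The smallest subset of `E × E*` that contains `S` and `0`, is closed under rational linear
combinations, and contains the norming functionals and norm-attaining vectors of its elements. -/
inductive NormingHull (S : Set (E × StrongDual ℝ E)) : Set (E × StrongDual ℝ E)
  | base {z} (hz : z ∈ S) : NormingHull S z
  | zero : NormingHull S 0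
  | comb (q : ℚ) {z w} (hz : NormingHull S z) (hw : NormingHull S w) :
      NormingHull S ((q : ℝ) • z + w)
  | norming {z} (hz : NormingHull S z) :
      NormingHull S (attainingVector z.2, normingFunctional z.1)

theorem normingHull_mono {S T : Set (E × StrongDual ℝ E)} (h : S ⊆ T) :
    NormingHull S ⊆ NormingHull T := by
  intro z hz
  change NormingHull S z at hz
  change NormingHull T z
  induction hz with
  | base hz => exact .base (h hz)
  | zero => exact .zero
  | comb q _ _ h₁ h₂ => exact .comb q h₁ h₂
  | norming _ h => exact .norming h

theorem normingHull_empty : NormingHull (∅ : Set (E × StrongDual ℝ E)) = {0} := by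
  ext z
  refine ⟨fun hz => ?_, fun hz => by rw [Set.mem_singleton_iff.1 hz]; exact .zero⟩
  change NormingHull _ z at hz
  induction hz with
  | base hz => exact absurd hz (Set.notMem_empty _)
  | zero => rfl
  | comb q _ _ h₁ h₂ => simp_all
  | norming _ h => simp_all [normingFunctional_zero, attainingVector_zero]

theorem normingHull_iUnion_subset {ι : Type*} [Nonempty ι] {S : ι → Set (E × StrongDual ℝ E)}
    (hS : Directed (· ⊆ ·) S) : NormingHull (⋃ i, S i) ⊆ ⋃ i, NormingHull (S i) := by
  intro z hz
  change NormingHull _ z at hz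
  induction hz with
  | base hz =>
    obtain ⟨i, hi⟩ := Set.mem_iUnion.1 hz
    exact Set.mem_iUnion.2 ⟨i, .base hi⟩
  | zero => exact Set.mem_iUnion.2 ⟨Classical.arbitrary ι, .zero⟩
  | comb q _ _ h₁ h₂ =>
    obtain ⟨i, hi⟩ := Set.mem_iUnion.1 h₁
    obtain ⟨j, hj⟩ := Set.mem_iUnion.1 h₂
    obtain ⟨k, hik, hjk⟩ := hS i j
    exact Set.mem_iUnion.2 ⟨k, .comb q (normingHull_mono hik hi) (normingHull_mono hjk hj)⟩
  | norming _ h =>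
    obtain ⟨i, hi⟩ := Set.mem_iUnion.1 h
    exact Set.mem_iUnion.2 ⟨i, .norming hi⟩

theorem normingHull_countable {S : Set (E × StrongDual ℝ E)} (hS : S.Countable) :
    (NormingHull S).Countable := by
  let step : Set (E × StrongDual ℝ E) → Set (E × StrongDual ℝ E) := fun A =>
    A ∪ ((⋃ q : ℚ, Set.image2 (fun z w => (q : ℝ) • z + w) A A) ∪
      (fun z => (attainingVector z.2, normingFunctional z.1)) '' A)
  have hstep : ∀ k, (step^[k] (insert 0 S)).Countable := by
    intro k
    induction k with
    | zero => exact hS.insert 0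
    | succ k ih =>
      rw [Function.iterate_succ_apply']
      exact ih.union ((Set.countable_iUnion fun q => ih.image2 ih _).union (ih.image _))
  have hmono : Monotone fun k => step^[k] (insert 0 S) := by
    refine monotone_nat_of_le_succ fun k => ?_
    rw [Function.iterate_succ_apply']
    exact Set.subset_union_left
  refine (Set.countable_iUnion hstep).mono fun z hz => ?_
  change NormingHull _ z at hz
  induction hz with
  | base hz => exact Set.mem_iUnion.2 ⟨0, Or.inr hz⟩
  | zero => exact Set.mem_iUnion.2 ⟨0, Or.inl rfl⟩
  | comb q _ _ h₁ h₂ =>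
    obtain ⟨i, hi⟩ := Set.mem_iUnion.1 h₁
    obtain ⟨j, hj⟩ := Set.mem_iUnion.1 h₂
    refine Set.mem_iUnion.2 ⟨max i j + 1, ?_⟩
    rw [Function.iterate_succ_apply']
    exact Or.inr (Or.inl (Set.mem_iUnion.2 ⟨q, Set.mem_image2_of_mem
      (hmono (le_max_left i j) hi) (hmono (le_max_right i j) hj)⟩))
  | norming _ h =>
    obtain ⟨i, hi⟩ := Set.mem_iUnion.1 h
    refine Set.mem_iUnion.2 ⟨i + 1, ?_⟩
    rw [Function.iterate_succ_apply']
    exact Or.inr (Or.inr (Set.mem_image_of_mem _ hi))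

theorem closure_smul_add_mem {F : Type*} [NormedAddCommGroup F] [NormedSpace ℝ F] {A : Set F}
    (hA : ∀ (q : ℚ), ∀ x ∈ A, ∀ y ∈ A, (q : ℝ) • x + y ∈ A) (c : ℝ) {x y : F}
    (hx : x ∈ closure A) (hy : y ∈ closure A) : c • x + y ∈ closure A := by
  have hc : c ∈ closure (Set.range ((↑) : ℚ → ℝ)) := Rat.denseRange_cast c
  have h := map_mem_closure₂ (f := fun (c : ℝ) (p : F × F) => c • p.1 + p.2)
    (t := A ×ˢ A) (u := A) (by fun_prop) hc
    (by rw [closure_prod_eq]; exact ⟨hx, hy⟩ : (x, y) ∈ closure (A ×ˢ A))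
  refine h ?_
  rintro _ ⟨q, rfl⟩ ⟨a, b⟩ ⟨ha, hb⟩
  exact hA q a ha b hb

/-- The closed subspace which is the closure of a set stable under rational combinations. -/
def closureSubmodule {F : Type*} [NormedAddCommGroup F] [NormedSpace ℝ F] (A : Set F)
    (h0 : (0 : F) ∈ A) (hA : ∀ (q : ℚ), ∀ x ∈ A, ∀ y ∈ A, (q : ℝ) • x + y ∈ A) :
    Submodule ℝ F where
  carrier := closure A
  zero_mem' := subset_closure h0
  add_mem' {x y} hx hy := by simpa using closure_smul_add_mem hA 1 hx hy
  smul_mem' c x hx := by simpa using closure_smul_add_mem hA c hx (subset_closure h0)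

/-- The closed subspace of `E` spanned by the first components of the norming hull. -/
def hullSpace (S : Set (E × StrongDual ℝ E)) : Submodule ℝ E :=
  closureSubmodule (Prod.fst '' NormingHull S) ⟨0, .zero, rfl⟩ (by
    rintro q _ ⟨z, hz, rfl⟩ _ ⟨w, hw, rfl⟩
    exact ⟨_, .comb q hz hw, rfl⟩)

/-- The closed subspace of `E*` spanned by the second components of the norming hull. -/
noncomputable def hullDual (S : Set (E × StrongDual ℝ E)) : Submodule ℝ (StrongDual ℝ E) :=
  closureSubmodule (Prod.snd '' NormingHull S) ⟨0, .zero, rfl⟩ (by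
    rintro q _ ⟨z, hz, rfl⟩ _ ⟨w, hw, rfl⟩
    exact ⟨_, .comb q hz hw, rfl⟩)

theorem mem_hullSpace_iff {S : Set (E × StrongDual ℝ E)} {x : E} :
    x ∈ hullSpace S ↔ x ∈ closure (Prod.fst '' NormingHull S) := Iff.rfl

theorem isClosed_hullSpace (S : Set (E × StrongDual ℝ E)) : IsClosed (hullSpace S : Set E) :=
  isClosed_closure

theorem isClosed_hullDual (S : Set (E × StrongDual ℝ E)) :
    IsClosed (hullDual S : Set (StrongDual ℝ E)) :=
  isClosed_closure

theorem hullSpace_mono {S T : Set (E × StrongDual ℝ E)} (h : S ⊆ T) :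
    hullSpace S ≤ hullSpace T :=
  closure_mono (Set.image_mono (normingHull_mono h))

theorem hullDual_mono {S T : Set (E × StrongDual ℝ E)} (h : S ⊆ T) :
    hullDual S ≤ hullDual T :=
  closure_mono (Set.image_mono (normingHull_mono h))

theorem fst_mem_hullSpace {S : Set (E × StrongDual ℝ E)} {z : E × StrongDual ℝ E} (hz : z ∈ S) :
    z.1 ∈ hullSpace S := subset_closure ⟨z, .base hz, rfl⟩

theorem snd_mem_hullDual {S : Set (E × StrongDual ℝ E)} {z : E × StrongDual ℝ E} (hz : z ∈ S) :
    z.2 ∈ hullDual S := subset_closure ⟨z, .base hz, rfl⟩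

/-- The common kernel of the functionals in `hullDual S`. -/
def hullKer (S : Set (E × StrongDual ℝ E)) : Submodule ℝ E where
  carrier := {x | ∀ f ∈ hullDual S, f x = 0}
  zero_mem' := by simp
  add_mem' {x y} hx hy f hf := by simp [hx f hf, hy f hf]
  smul_mem' c x hx f hf := by simp [hx f hf]

theorem mem_hullKer_iff {S : Set (E × StrongDual ℝ E)} {x : E} :
    x ∈ hullKer S ↔ ∀ f ∈ hullDual S, f x = 0 := Iff.rfl

theorem isClosed_hullKer (S : Set (E × StrongDual ℝ E)) : IsClosed (hullKer S : Set E) := by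
  have : (hullKer S : Set E) = ⋂ f ∈ hullDual S, {x | f x = 0} := by
    ext x; simp [mem_hullKer_iff]
  rw [this]
  exact isClosed_biInter fun f _ => isClosed_eq f.continuous continuous_const

theorem norm_le_norm_add_of_mem_hull {S : Set (E × StrongDual ℝ E)} {a b : E}
    (ha : a ∈ hullSpace S) (hb : b ∈ hullKer S) : ‖a‖ ≤ ‖a + b‖ := by
  have hcl : IsClosed {a : E | ‖a‖ ≤ ‖a + b‖} := isClosed_le (by fun_prop) (by fun_prop)
  refine closure_minimal ?_ hcl ha
  rintro _ ⟨z, hz, rfl⟩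
  have hf : normingFunctional z.1 ∈ hullDual S := subset_closure ⟨_, .norming hz, rfl⟩
  calc ‖z.1‖ = normingFunctional z.1 (z.1 + b) := by
        rw [map_add, hb _ hf, add_zero, normingFunctional_apply]
    _ ≤ ‖normingFunctional z.1 (z.1 + b)‖ := le_abs_self _
    _ ≤ ‖normingFunctional z.1‖ * ‖z.1 + b‖ := ContinuousLinearMap.le_opNorm _ _
    _ ≤ 1 * ‖z.1 + b‖ := by gcongr; exact norm_normingFunctional_le _
    _ = _ := one_mul _

theorem exists_dual_eq_zero_of_notMem {F : Type*} [NormedAddCommGroup F] [NormedSpace ℝ F]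
    {A : Submodule ℝ F} (hA : IsClosed (A : Set F)) {x : F} (hx : x ∉ A) :
    ∃ f : StrongDual ℝ F, (∀ a ∈ A, f a = 0) ∧ f x ≠ 0 := by
  obtain ⟨f, u, hu, hux⟩ := geometric_hahn_banach_closed_point A.convex hA hx
  have hf : ∀ a ∈ A, f a = 0 := by
    intro a ha
    by_contra h
    have := hu _ (A.smul_mem ((u + 1) / f a) ha)
    rw [map_smul, smul_eq_mul, div_mul_cancel₀ _ h] at this
    linarith
  have h0 := hu 0 A.zero_mem
  rw [map_zero] at h0
  exact ⟨f, hf, (h0.trans hux).ne'⟩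

theorem IsReflexiveSpace.mem_hullDual (hE : IsReflexiveSpace E) {S : Set (E × StrongDual ℝ E)}
    {f : StrongDual ℝ E} (hf : ∀ x ∈ hullKer S, f x = 0) : f ∈ hullDual S := by
  by_contra h
  obtain ⟨Ξ, hΞ, hΞf⟩ := exists_dual_eq_zero_of_notMem (isClosed_hullDual S) h
  obtain ⟨x, rfl⟩ := hE Ξ
  exact hΞf (by simpa using hf x fun g hg => by simpa using hΞ g hg)

theorem IsReflexiveSpace.eq_zero_of_mem_hullDual (hE : IsReflexiveSpace E)
    {S : Set (E × StrongDual ℝ E)} {f : StrongDual ℝ E} (hf : f ∈ hullDual S)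
    (h0 : ∀ x ∈ hullSpace S, f x = 0) : f = 0 := by
  rw [← norm_le_zero_iff]
  refine le_of_forall_pos_le_add fun ε hε => ?_
  obtain ⟨_, ⟨z, hz, rfl⟩, hzf⟩ := Metric.mem_closure_iff.1 hf (ε / 2) (half_pos hε)
  rw [dist_eq_norm] at hzf
  have hx : f (attainingVector z.2) = 0 := h0 _ (subset_closure ⟨_, .norming hz, rfl⟩)
  have h1 : ‖z.2‖ ≤ ε / 2 := by
    calc ‖z.2‖ = (z.2 - f) (attainingVector z.2) := by
          simp [hx, hE.apply_attainingVector]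
      _ ≤ ‖z.2 - f‖ * ‖attainingVector z.2‖ := (le_abs_self _).trans ((z.2 - f).le_opNorm _)
      _ ≤ ‖z.2 - f‖ * 1 := by gcongr; exact norm_attainingVector_le _
      _ ≤ ε / 2 := by rw [mul_one, norm_sub_rev]; exact hzf.le
  calc ‖f‖ = ‖(f - z.2) + z.2‖ := by simp
    _ ≤ ‖f - z.2‖ + ‖z.2‖ := norm_add_le _ _
    _ ≤ 0 + ε := by linarith

theorem IsReflexiveSpace.isCompl_hull [CompleteSpace E] (hE : IsReflexiveSpace E)
    (S : Set (E × StrongDual ℝ E)) : IsCompl (hullSpace S) (hullKer S) := by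
  constructor
  · rw [Submodule.disjoint_def]
    intro x hx hx'
    simpa using norm_le_norm_add_of_mem_hull hx ((hullKer S).neg_mem hx')
  · rw [codisjoint_iff]
    by_contra hne
    obtain ⟨x, hx⟩ : ∃ x, x ∉ hullSpace S ⊔ hullKer S := by
      by_contra! h
      exact hne (Submodule.eq_top_iff'.2 h)
    have hcl : IsClosed ((hullSpace S ⊔ hullKer S : Submodule ℝ E) : Set E) := by
      refine isClosed_of_closure_subset fun d hd => ?_
      obtain ⟨u, hu, hud⟩ := mem_closure_iff_seq_limit.1 hd
      choose a ha b hb hab using fun k => Submodule.mem_sup.1 (hu k)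
      have hcau : CauchySeq a := by
        refine Metric.cauchySeq_iff.2 fun ε hε => ?_
        obtain ⟨N, hN⟩ := Metric.cauchySeq_iff.1 hud.cauchySeq ε hε
        refine ⟨N, fun m hm n hn => lt_of_le_of_lt ?_ (hN m hm n hn)⟩
        rw [dist_eq_norm, dist_eq_norm, ← hab, ← hab, add_sub_add_comm]
        exact norm_le_norm_add_of_mem_hull ((hullSpace S).sub_mem (ha m) (ha n))
          ((hullKer S).sub_mem (hb m) (hb n))
      obtain ⟨a', ha'⟩ := cauchySeq_tendsto_of_complete hcau
      have hmem : a' ∈ hullSpace S :=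
        (isClosed_hullSpace S).mem_of_tendsto ha' (Eventually.of_forall ha)
      have hb' : Tendsto b atTop (𝓝 (d - a')) := by
        refine (hud.sub ha').congr fun k => ?_
        rw [← hab]; abel
      have hmem' : d - a' ∈ hullKer S :=
        (isClosed_hullKer S).mem_of_tendsto hb' (Eventually.of_forall hb)
      exact Submodule.mem_sup.2 ⟨a', hmem, d - a', hmem', by abel⟩
    obtain ⟨f, hf, hfx⟩ := exists_dual_eq_zero_of_notMem hcl hx
    refine hfx ?_
    rw [hE.eq_zero_of_mem_hullDual
      (hE.mem_hullDual fun y hy => hf y (Submodule.mem_sup_right hy))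
      fun y hy => hf y (Submodule.mem_sup_left hy)]
    rfl

/-- The norm-one projection of a reflexive space onto `hullSpace S` along `hullKer S`. -/
noncomputable def hullProj [CompleteSpace E] (hE : IsReflexiveSpace E)
    (S : Set (E × StrongDual ℝ E)) : E →L[ℝ] E :=
  ((hullSpace S).projection (hullKer S) (hE.isCompl_hull S)).mkContinuous 1 fun x => by
    rw [one_mul]
    refine (norm_le_norm_add_of_mem_hull (Submodule.projection_apply_mem _ x)
      (Submodule.sub_projection_mem (hE.isCompl_hull S) x)).trans_eq ?_
    congr 1
    abel

variable [CompleteSpace E] (hE : IsReflexiveSpace E) {S T : Set (E × StrongDual ℝ E)}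

theorem norm_hullProj_le (x : E) : ‖hullProj hE S x‖ ≤ ‖x‖ := by
  simpa using ((hullProj hE S).le_opNorm x).trans (mul_le_mul_of_nonneg_right
    (LinearMap.mkContinuous_norm_le _ zero_le_one _) (norm_nonneg x))

theorem hullProj_mem (x : E) : hullProj hE S x ∈ hullSpace S :=
  Submodule.projection_apply_mem (hE.isCompl_hull S) x

theorem sub_hullProj_mem (x : E) : x - hullProj hE S x ∈ hullKer S :=
  Submodule.sub_projection_mem (hE.isCompl_hull S) x

theorem hullProj_eq_self {x : E} (hx : x ∈ hullSpace S) : hullProj hE S x = x :=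
  Submodule.projection_apply_of_mem_left (hE.isCompl_hull S) hx

theorem hullProj_eq_zero {x : E} (hx : x ∈ hullKer S) : hullProj hE S x = 0 :=
  (Submodule.projection_apply_eq_zero_iff (hE.isCompl_hull S)).2 hx

theorem hullProj_hullProj_of_subset (h : S ⊆ T) (x : E) :
    hullProj hE T (hullProj hE S x) = hullProj hE S x :=
  hullProj_eq_self hE (hullSpace_mono h (hullProj_mem hE x))

theorem hullProj_hullProj_of_superset (h : S ⊆ T) (x : E) :
    hullProj hE S (hullProj hE T x) = hullProj hE S x := by
  have hx : x - hullProj hE T x ∈ hullKer S := fun f hf =>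
    sub_hullProj_mem hE x f (hullDual_mono h hf)
  have := hullProj_eq_zero hE hx
  rw [map_sub, sub_eq_zero] at this
  exact this.symm

theorem hullProj_empty (x : E) : hullProj hE ∅ x = 0 := by
  have := hullProj_mem hE (S := ∅) x
  rw [mem_hullSpace_iff, normingHull_empty] at this
  simpa using this

theorem hullProj_apply_eq_of_mem_hullDual {f : StrongDual ℝ E} (hf : f ∈ hullDual S) (x : E) :
    f (hullProj hE S x) = f x := by
  have := sub_hullProj_mem hE x f hf
  rw [map_sub, sub_eq_zero] at this
  exact this.symm

theorem comp_hullProj_mem_hullDual (f : StrongDual ℝ E) : f.comp (hullProj hE S) ∈ hullDual S :=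
  hE.mem_hullDual fun x hx => by simp [hullProj_eq_zero hE hx]

/-- Along a directed union of sets the projections converge pointwise. -/
theorem exists_norm_hullProj_iUnion_sub_le {ι : Type*} [Nonempty ι]
    {S : ι → Set (E × StrongDual ℝ E)} (hS : Directed (· ⊆ ·) S) (x : E) {ε : ℝ} (hε : 0 < ε) :
    ∃ i, ‖hullProj hE (⋃ j, S j) x - hullProj hE (S i) x‖ ≤ ε := by
  set y := hullProj hE (⋃ j, S j) x with hy
  obtain ⟨_, ⟨z, hz, rfl⟩, hzy⟩ :=
    Metric.mem_closure_iff.1 (hullProj_mem hE (S := ⋃ j, S j) x) (ε / 2) (half_pos hε)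
  obtain ⟨i, hi⟩ := Set.mem_iUnion.1 (normingHull_iUnion_subset hS hz)
  rw [dist_eq_norm, ← hy] at hzy
  refine ⟨i, ?_⟩
  have hzi : hullProj hE (S i) z.1 = z.1 := hullProj_eq_self hE (subset_closure ⟨z, hi, rfl⟩)
  have : y - hullProj hE (S i) x = (y - z.1) - hullProj hE (S i) (y - z.1) := by
    rw [map_sub, hzi, hy, hullProj_hullProj_of_superset hE (Set.subset_iUnion S i)]
    abel
  rw [this]
  have h1 := norm_sub_le (y - z.1) (hullProj hE (S i) (y - z.1))
  have h2 := norm_hullProj_le hE (S := S i) (y - z.1)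
  linarith

end Hull

section NullFamily

theorem directed_restrict {I α : Type*} [LinearOrder I] {U : I → Set α} (hU : Monotone U)
    (D : Set I) :
    Directed (· ⊆ ·) fun j : D => U j :=
  fun i j => (le_total i.1 j.1).elim (fun h => ⟨j, hU h, subset_rfl⟩) fun h => ⟨i, subset_rfl, hU h⟩

variable {E : Type*} [NormedAddCommGroup E] [NormedSpace ℝ E]

/-- A set of functionals in the unit ball of `E*` such that `(f x)_f` vanishes at infinity for
every `x`. -/
structure IsNullFamily (F : Set (StrongDual ℝ E)) : Prop where
  norm_le : ∀ f ∈ F, ‖f‖ ≤ 1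
  finite : ∀ (x : E) (ε : ℝ), 0 < ε → {f ∈ F | ε ≤ |f x|}.Finite

theorem exists_isNullFamily_of_countable {S : Set (E × StrongDual ℝ E)} (hS : S.Countable) :
    ∃ F : Set (StrongDual ℝ E), IsNullFamily F ∧
      ∀ x ∈ hullSpace S, (∀ f ∈ F, f x = 0) → x = 0 := by
  have hne : (NormingHull S).Nonempty := ⟨0, .zero⟩
  obtain ⟨z, hz⟩ := (normingHull_countable hS).exists_eq_range hne
  have hle : ∀ k : ℕ, ‖((k : ℝ) + 1)⁻¹ • normingFunctional (z k).1‖ ≤ ((k : ℝ) + 1)⁻¹ := by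
    intro k
    rw [norm_smul, Real.norm_of_nonneg (by positivity)]
    exact mul_le_of_le_one_right (by positivity) (norm_normingFunctional_le _)
  refine ⟨Set.range fun k : ℕ => ((k : ℝ) + 1)⁻¹ • normingFunctional (z k).1, ⟨?_, ?_⟩, ?_⟩
  · rintro _ ⟨k, rfl⟩
    refine (hle k).trans (inv_le_one_of_one_le₀ ?_)
    have : (0 : ℝ) ≤ k := by positivity
    linarith
  · intro x ε hε
    obtain ⟨N, hN⟩ := exists_nat_gt (‖x‖ / ε)
    refine ((Set.finite_lt_nat N).image
      fun k : ℕ => ((k : ℝ) + 1)⁻¹ • normingFunctional (z k).1).subset ?_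
    rintro _ ⟨⟨k, rfl⟩, hk⟩
    refine ⟨k, ?_, rfl⟩
    have h1 : ε ≤ ((k : ℝ) + 1)⁻¹ * ‖x‖ :=
      hk.trans ((ContinuousLinearMap.le_opNorm _ x).trans
        (mul_le_mul_of_nonneg_right (hle k) (norm_nonneg x)))
    have hk0 : (0 : ℝ) < k + 1 := by positivity
    rw [inv_mul_eq_div, le_div_iff₀ hk0] at h1
    rw [div_lt_iff₀ hε] at hN
    have : ε * ((k : ℝ) + 1) < ε * N := by linarith
    have := lt_of_mul_lt_mul_left this hε.le
    have : (k : ℝ) < N := by linarith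
    exact_mod_cast this
  · intro x hx h0
    rw [← norm_le_zero_iff]
    refine le_of_forall_pos_le_add fun ε hε => ?_
    obtain ⟨_, ⟨w, hw, rfl⟩, hwx⟩ := Metric.mem_closure_iff.1 hx (ε / 2) (half_pos hε)
    rw [hz] at hw
    obtain ⟨k, rfl⟩ := hw
    rw [dist_eq_norm] at hwx
    have hk : normingFunctional (z k).1 x = 0 := by
      have := h0 _ ⟨k, rfl⟩
      have hk0 : ((k : ℝ) + 1)⁻¹ ≠ 0 := by positivity
      simpa [hk0] using this
    have h1 : ‖(z k).1‖ ≤ ‖x - (z k).1‖ := by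
      calc ‖(z k).1‖ = -normingFunctional (z k).1 (x - (z k).1) := by
            rw [map_sub, hk, normingFunctional_apply]; ring
        _ ≤ ‖normingFunctional (z k).1‖ * ‖x - (z k).1‖ :=
            (neg_le_abs _).trans ((normingFunctional (z k).1).le_opNorm _)
        _ ≤ 1 * ‖x - (z k).1‖ := by gcongr; exact norm_normingFunctional_le _
        _ = _ := one_mul _
    calc ‖x‖ = ‖(x - (z k).1) + (z k).1‖ := by simp
      _ ≤ ‖x - (z k).1‖ + ‖(z k).1‖ := norm_add_le _ _
      _ ≤ 0 + ε := by linarith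

variable [CompleteSpace E] (hE : IsReflexiveSpace E)
  {I : Type*} [LinearOrder I] {U : I → Set (E × StrongDual ℝ E)}

/-- The increment of the projections at the index `i`. -/
noncomputable def hullIncr (U : I → Set (E × StrongDual ℝ E)) (i : I) : E →L[ℝ] E :=
  hullProj hE (U i) - hullProj hE (⋃ j : Set.Iio i, U j)

theorem hullIncr_apply (i : I) (x : E) : hullIncr hE U i x =
    hullProj hE (U i) x - hullProj hE (⋃ j : Set.Iio i, U j) x := rfl

theorem norm_hullIncr_le (i : I) (x : E) : ‖hullIncr hE U i x‖ ≤ 2 * ‖x‖ := by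
  have h1 := norm_sub_le (hullProj hE (U i) x) (hullProj hE (⋃ j : Set.Iio i, U j) x)
  have h2 := norm_hullProj_le hE (S := U i) x
  have h3 := norm_hullProj_le hE (S := ⋃ j : Set.Iio i, U j) x
  rw [hullIncr_apply]
  linarith

theorem finite_hullIncr_of_lowerSet (hU : Monotone U) {D : Set I} (hD : IsLowerSet D) (x : E)
    {ε : ℝ} (hε : 0 < ε) (hfin : ∀ i ∈ D, {j | j < i ∧ ε ≤ ‖hullIncr hE U j x‖}.Finite) :
    {j | j ∈ D ∧ ε ≤ ‖hullIncr hE U j x‖}.Finite := by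
  rcases D.eq_empty_or_nonempty with rfl | hne
  · simp
  have : Nonempty D := hne.to_subtype
  obtain ⟨⟨i, hi⟩, hix⟩ := exists_norm_hullProj_iUnion_sub_le hE (directed_restrict hU D) x
    (show 0 < ε / 4 by positivity)
  refine ((hfin i hi).insert i).subset ?_
  rintro j ⟨hj, hjx⟩
  rcases lt_trichotomy j i with h | rfl | h
  · exact Or.inr ⟨h, hjx⟩
  · exact Or.inl rfl
  · exfalso
    have hiL : U i ⊆ ⋃ k : Set.Iio j, U k := Set.subset_iUnion (fun k : Set.Iio j => U k) ⟨i, h⟩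
    have hjD : U j ⊆ ⋃ k : D, U k := Set.subset_iUnion (fun k : D => U k) ⟨j, hj⟩
    have hLD : (⋃ k : Set.Iio j, U k) ⊆ ⋃ k : D, U k :=
      Set.iUnion_subset fun k => (hU k.2.le).trans hjD
    have hQ : hullIncr hE U j x =
        hullIncr hE U j (hullProj hE (⋃ k : D, U k) x - hullProj hE (U i) x) := by
      simp only [hullIncr_apply, map_sub,
        hullProj_hullProj_of_superset hE hjD, hullProj_hullProj_of_superset hE hLD,
        hullProj_hullProj_of_subset hE (hU h.le), hullProj_hullProj_of_subset hE hiL]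
      abel
    rw [hQ] at hjx
    have := norm_hullIncr_le hE (U := U) j (hullProj hE (⋃ k : D, U k) x - hullProj hE (U i) x)
    linarith

theorem finite_hullIncr [WellFoundedLT I] (hU : Monotone U) (x : E) {ε : ℝ} (hε : 0 < ε) :
    {j | ε ≤ ‖hullIncr hE U j x‖}.Finite := by
  have key : ∀ i : I, {j | j < i ∧ ε ≤ ‖hullIncr hE U j x‖}.Finite := by
    intro i
    induction i using WellFoundedLT.induction with
    | ind i ih => exact finite_hullIncr_of_lowerSet hE hU (isLowerSet_Iio i) x hε ih
  simpa using finite_hullIncr_of_lowerSet hE hU isLowerSet_univ x hε fun i _ => key i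

theorem hullProj_iUnion_eq_zero (hU : Monotone U) {D : Set I} {x : E}
    (h : ∀ i ∈ D, hullProj hE (U i) x = 0) : hullProj hE (⋃ j : D, U j) x = 0 := by
  rcases D.eq_empty_or_nonempty with rfl | hne
  · simpa using hullProj_empty hE x
  have : Nonempty D := hne.to_subtype
  rw [← norm_le_zero_iff]
  refine le_of_forall_pos_le_add fun ε hε => ?_
  obtain ⟨⟨i, hi⟩, hix⟩ := exists_norm_hullProj_iUnion_sub_le hE (directed_restrict hU D) x hε
  rw [h i hi, sub_zero] at hix
  simpa using hix

theorem hullProj_eq_zero_of_hullIncr [WellFoundedLT I] (hU : Monotone U) {x : E}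
    (h : ∀ i, hullIncr hE U i x = 0) (i : I) : hullProj hE (U i) x = 0 := by
  induction i using WellFoundedLT.induction with
  | ind i ih =>
    have := h i
    rw [hullIncr_apply, sub_eq_zero] at this
    rw [this]
    exact hullProj_iUnion_eq_zero hE hU ih

theorem exists_isNullFamily_iUnion (hE : IsReflexiveSpace E) [WellFoundedLT I] (hU : Monotone U)
    (h : ∀ i, ∃ F : Set (StrongDual ℝ E), IsNullFamily F ∧
      ∀ x ∈ hullSpace (U i), (∀ f ∈ F, f x = 0) → x = 0) :
    ∃ F : Set (StrongDual ℝ E), IsNullFamily F ∧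
      ∀ x ∈ hullSpace (⋃ i, U i), (∀ f ∈ F, f x = 0) → x = 0 := by
  choose F hF hF0 using h
  let c : I → StrongDual ℝ E → StrongDual ℝ E := fun i f => (2⁻¹ : ℝ) • f.comp (hullIncr hE U i)
  have hc : ∀ i f x, c i f x = 2⁻¹ * f (hullIncr hE U i x) := fun i f x => rfl
  refine ⟨⋃ i, c i '' F i, ⟨?_, ?_⟩, ?_⟩
  · simp only [Set.mem_iUnion]
    rintro _ ⟨i, f, hf, rfl⟩
    refine ContinuousLinearMap.opNorm_le_bound _ zero_le_one fun x => ?_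
    rw [hc, norm_mul, Real.norm_of_nonneg (by norm_num : (0 : ℝ) ≤ 2⁻¹)]
    have h1 := f.le_opNorm (hullIncr hE U i x)
    have h2 := norm_hullIncr_le hE (U := U) i x
    have h3 := mul_le_mul ((hF i).norm_le f hf) h2 (norm_nonneg _) zero_le_one
    linarith
  · intro x ε hε
    have hfin := finite_hullIncr hE hU x hε
    refine (hfin.biUnion fun i _ => ((hF i).finite (hullIncr hE U i x) ε hε).image (c i)).subset ?_
    rintro g ⟨hg, hgx⟩
    obtain ⟨i, f, hf, rfl⟩ := Set.mem_iUnion.1 hg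
    rw [hc, abs_mul, abs_of_nonneg (by norm_num : (0 : ℝ) ≤ 2⁻¹)] at hgx
    have h0 := abs_nonneg (f (hullIncr hE U i x))
    have h1 := (f.le_opNorm (hullIncr hE U i x)).trans
      (mul_le_of_le_one_left (norm_nonneg _) ((hF i).norm_le f hf))
    rw [Real.norm_eq_abs] at h1
    refine Set.mem_biUnion (x := i) (by simp only [Set.mem_ofPred_eq]; linarith) ⟨f, ⟨hf, ?_⟩, rfl⟩
    linarith
  · intro x hx h0
    have hincr : ∀ i, hullIncr hE U i x = 0 := by
      intro i
      refine hF0 i _ ?_ fun f hf => ?_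
      · exact (hullSpace (U i)).sub_mem (hullProj_mem hE x)
          (hullSpace_mono (Set.iUnion_subset fun j => hU j.2.le) (hullProj_mem hE x))
      · have := h0 (c i f) (Set.mem_iUnion.2 ⟨i, f, hf, rfl⟩)
        rw [hc] at this
        simpa using this
    rw [← hullProj_eq_self hE hx]
    have := hullProj_iUnion_eq_zero hE hU (D := Set.univ)
      fun i _ => hullProj_eq_zero_of_hullIncr hE hU hincr i
    rwa [Set.iUnion_coe_set, Set.biUnion_univ] at this

theorem exists_isNullFamily_hull (hE : IsReflexiveSpace E) (S : Set (E × StrongDual ℝ E)) :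
    ∃ F : Set (StrongDual ℝ E), IsNullFamily F ∧
      ∀ x ∈ hullSpace S, (∀ f ∈ F, f x = 0) → x = 0 := by
  suffices ∀ κ : Cardinal, ∀ S : Set (E × StrongDual ℝ E), Cardinal.mk S = κ →
      ∃ F : Set (StrongDual ℝ E), IsNullFamily F ∧
        ∀ x ∈ hullSpace S, (∀ f ∈ F, f x = 0) → x = 0 from this _ S rfl
  intro κ
  induction κ using WellFoundedLT.induction with
  | ind κ ih =>
    intro S hS
    by_cases hκ : κ ≤ Cardinal.aleph0
    · exact exists_isNullFamily_of_countable (Cardinal.le_aleph0_iff_set_countable.1 (hS ▸ hκ))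
    · rw [not_le] at hκ
      obtain ⟨e⟩ : Nonempty (κ.ord.ToType ≃ S) := by
        rw [← Cardinal.eq, Cardinal.mk_ord_toType, hS]
      let U : κ.ord.ToType → Set (E × StrongDual ℝ E) := fun i => (fun j => (e j).1) '' Set.Iic i
      have hU : Monotone U := fun i j hij => Set.image_mono (Set.Iic_subset_Iic.2 hij)
      have hUS : ⋃ i, U i = S := by
        ext z
        simp only [U, Set.mem_iUnion, Set.mem_image, Set.mem_Iic]
        constructor
        · rintro ⟨_, j, _, rfl⟩
          exact (e j).2
        · intro hz
          exact ⟨e.symm ⟨z, hz⟩, e.symm ⟨z, hz⟩, le_rfl, by simp⟩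
      rw [← hUS]
      refine exists_isNullFamily_iUnion hE hU fun i => ih _ ?_ (U i) rfl
      have h1 : Cardinal.mk (Set.Iio i) < κ := by simpa using Cardinal.mk_Iio_lt i
      calc Cardinal.mk (U i) ≤ Cardinal.mk (Set.Iic i) := Cardinal.mk_image_le
        _ = Cardinal.mk (insert i (Set.Iio i) : Set _) := by rw [Set.Iio_insert]
        _ ≤ Cardinal.mk (Set.Iio i) + 1 := Cardinal.mk_insert_le
        _ < κ := Cardinal.add_lt_of_lt hκ.le h1 (Cardinal.one_lt_aleph0.trans hκ)

/-- **Amir–Lindenstrauss**: a reflexive space admits a bounded total family of functionals that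
vanishes at infinity at every point. -/
theorem IsReflexiveSpace.exists_isNullFamily (hE : IsReflexiveSpace E) :
    ∃ F : Set (StrongDual ℝ E), IsNullFamily F ∧ ∀ x : E, (∀ f ∈ F, f x = 0) → x = 0 := by
  obtain ⟨F, hF, h⟩ := exists_isNullFamily_hull hE Set.univ
  exact ⟨F, hF, fun x => h x (fst_mem_hullSpace (z := (x, 0)) (Set.mem_univ _))⟩

end NullFamily

section WeakSequentialCompactness

variable {E : Type*} [NormedAddCommGroup E] [NormedSpace ℝ E]

theorem exists_subseq_tendsto_of_countable {ι : Type*} [Countable ι] {u : ℕ → ι → ℝ} {R : ι → ℝ}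
    (hu : ∀ n i, |u n i| ≤ R i) :
    ∃ κ : ℕ → ℕ, StrictMono κ ∧ ∀ i, ∃ l, Tendsto (fun n => u (κ n) i) atTop (𝓝 l) := by
  have hc : IsCompact (Set.pi Set.univ fun i => Set.Icc (-R i) (R i)) :=
    isCompact_univ_pi fun i => isCompact_Icc
  obtain ⟨l, -, κ, hκ, hl⟩ := hc.tendsto_subseq fun n i _ => abs_le.1 (hu n i)
  exact ⟨κ, hκ, fun i => ⟨l i, (tendsto_pi_nhds.1 hl) i⟩⟩

theorem exists_tendsto_of_mem_closure {u : ℕ → StrongDual ℝ E} {R : ℝ} (hu : ∀ n, ‖u n‖ ≤ R)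
    {A : Set E} (hA : ∀ a ∈ A, ∃ l, Tendsto (fun n => u n a) atTop (𝓝 l)) {x : E}
    (hx : x ∈ closure A) : ∃ l, Tendsto (fun n => u n x) atTop (𝓝 l) := by
  refine cauchySeq_tendsto_of_complete (Metric.cauchySeq_iff'.2 fun ε hε => ?_)
  have hR : 0 ≤ R := (norm_nonneg _).trans (hu 0)
  obtain ⟨a, ha, hxa⟩ := Metric.mem_closure_iff.1 hx (ε / (4 * (R + 1))) (by positivity)
  obtain ⟨l, hl⟩ := hA a ha
  obtain ⟨N, hN⟩ := Metric.cauchySeq_iff'.1 hl.cauchySeq (ε / 4) (by positivity)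
  refine ⟨N, fun n hn => ?_⟩
  have h1 : ∀ n, |u n (x - a)| ≤ ε / 4 := by
    intro n
    rw [dist_eq_norm, lt_div_iff₀ (by positivity)] at hxa
    have h2 := (u n).le_opNorm (x - a)
    have h3 := mul_le_mul_of_nonneg_right (hu n) (norm_nonneg (x - a))
    have h4 := norm_nonneg (x - a)
    rw [Real.norm_eq_abs] at h2
    linarith
  have h5 := hN n hn
  have e : u n x - u N x = u n (x - a) + (u n a - u N a) - u N (x - a) := by
    simp only [map_sub]; ring
  rw [Real.dist_eq] at h5 ⊢
  rw [e]
  have h6 := abs_sub (u n (x - a) + (u n a - u N a)) (u N (x - a))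
  have h7 := abs_add_le (u n (x - a)) (u n a - u N a)
  have h8 := h1 n
  have h9 := h1 N
  linarith

variable [CompleteSpace E]

theorem exists_dual_tendsto_of_pointwise {u : ℕ → StrongDual ℝ E}
    (h : ∀ x, ∃ l, Tendsto (fun n => u n x) atTop (𝓝 l)) :
    ∃ f : StrongDual ℝ E, ∀ x, Tendsto (fun n => u n x) atTop (𝓝 (f x)) := by
  choose l hl using h
  exact ⟨continuousLinearMapOfTendsto u (tendsto_pi_nhds.2 hl), hl⟩

/-- Bounded sequences in a reflexive space have weakly convergent subsequences. -/
theorem IsReflexiveSpace.exists_subseq_tendsto_weakly (hE : IsReflexiveSpace E) {v : ℕ → E} {R : ℝ}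
    (hv : ∀ n, ‖v n‖ ≤ R) : ∃ x : E, ∃ κ : ℕ → ℕ, StrictMono κ ∧
      ∀ f : StrongDual ℝ E, Tendsto (fun n => f (v (κ n))) atTop (𝓝 (f x)) := by
  let S : Set (E × StrongDual ℝ E) := Set.range fun n => (v n, 0)
  have hvS : ∀ n, v n ∈ hullSpace S := fun n => fst_mem_hullSpace (z := (v n, 0)) ⟨n, rfl⟩
  have hc : (Prod.snd '' NormingHull S).Countable :=
    (normingHull_countable (Set.countable_range _)).image _
  have : Countable (Prod.snd '' NormingHull S) := hc.to_subtype
  obtain ⟨κ, hκ, hl⟩ := exists_subseq_tendsto_of_countable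
    (u := fun n (f : Prod.snd '' NormingHull S) => f.1 (v n)) (R := fun f => ‖f.1‖ * R)
    fun n f => (f.1.le_opNorm (v n)).trans (by gcongr; exact hv n)
  have hu : ∀ n, ‖NormedSpace.inclusionInDoubleDual ℝ E (v (κ n))‖ ≤ R := fun n =>
    ((NormedSpace.inclusionInDoubleDualLi ℝ (E := E)).norm_map _).trans_le (hv _)
  have hall : ∀ f : StrongDual ℝ E, ∃ l, Tendsto
      (fun n => NormedSpace.inclusionInDoubleDual ℝ E (v (κ n)) f) atTop (𝓝 l) := by
    intro f
    obtain ⟨l, hl⟩ := exists_tendsto_of_mem_closure hu (A := Prod.snd '' NormingHull S)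
      (fun a ha => hl ⟨a, ha⟩) (comp_hullProj_mem_hullDual hE (S := S) f)
    refine ⟨l, hl.congr fun n => ?_⟩
    simp [hullProj_eq_self hE (hvS (κ n))]
  obtain ⟨Ξ, hΞ⟩ := exists_dual_tendsto_of_pointwise hall
  obtain ⟨x, rfl⟩ := hE Ξ
  exact ⟨x, κ, hκ, hΞ⟩

/-- Bounded sequences in the dual of a reflexive space have pointwise convergent subsequences. -/
theorem IsReflexiveSpace.exists_subseq_tendsto_dual (hE : IsReflexiveSpace E)
    {u : ℕ → StrongDual ℝ E} {R : ℝ} (hu : ∀ n, ‖u n‖ ≤ R) :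
    ∃ f : StrongDual ℝ E, ∃ κ : ℕ → ℕ, StrictMono κ ∧
      ∀ x, Tendsto (fun n => u (κ n) x) atTop (𝓝 (f x)) := by
  let S : Set (E × StrongDual ℝ E) := Set.range fun n => (0, u n)
  have huS : ∀ n, u n ∈ hullDual S := fun n => snd_mem_hullDual (z := (0, u n)) ⟨n, rfl⟩
  have hc : (Prod.fst '' NormingHull S).Countable :=
    (normingHull_countable (Set.countable_range _)).image _
  have : Countable (Prod.fst '' NormingHull S) := hc.to_subtype
  obtain ⟨κ, hκ, hl⟩ := exists_subseq_tendsto_of_countable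
    (u := fun n (x : Prod.fst '' NormingHull S) => u n x.1) (R := fun x => R * ‖x.1‖)
    fun n x => ((u n).le_opNorm x.1).trans (by gcongr; exact hu n)
  have hall : ∀ x : E, ∃ l, Tendsto (fun n => u (κ n) x) atTop (𝓝 l) := by
    intro x
    obtain ⟨l, hl⟩ := exists_tendsto_of_mem_closure (u := fun n => u (κ n)) (fun n => hu _)
      (A := Prod.fst '' NormingHull S) (fun a ha => hl ⟨a, ha⟩) (hullProj_mem hE (S := S) x)
    refine ⟨l, hl.congr fun n => ?_⟩
    exact hullProj_apply_eq_of_mem_hullDual hE (huS (κ n)) x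
  obtain ⟨f, hf⟩ := exists_dual_tendsto_of_pointwise hall
  exact ⟨f, κ, hκ, hf⟩

end WeakSequentialCompactness

section SmoothGauge

theorem lowerSemicontinuousOn_tsum_of_nonneg {X ι : Type*} [TopologicalSpace X] {K : Set X}
    {g : ι → X → ℝ} (h0 : ∀ i, ∀ p ∈ K, 0 ≤ g i p) (hs : ∀ p ∈ K, Summable fun i => g i p)
    (hg : ∀ i, LowerSemicontinuousOn (g i) K) :
    LowerSemicontinuousOn (fun p => ∑' i, g i p) K := by
  intro p hp y hy
  obtain ⟨s, hsy⟩ := ((hs p hp).hasSum.eventually (lt_mem_nhds hy)).exists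
  have hfin : LowerSemicontinuousOn (fun p => ∑ i ∈ s, g i p) K :=
    lowerSemicontinuousOn_sum fun i _ => hg i
  filter_upwards [hfin p hp y hsy, self_mem_nhdsWithin] with p' hp' hK
  exact hp'.trans_le ((hs p' hK).sum_le_tsum s fun i _ => h0 i p' hK)

theorem LowerSemicontinuousOn.sq_of_nonneg {X : Type*} [TopologicalSpace X] {K : Set X}
    {g : X → ℝ} (hg : LowerSemicontinuousOn g K) (h0 : ∀ p ∈ K, 0 ≤ g p) :
    LowerSemicontinuousOn (fun p => g p ^ 2) K := by
  intro p hp y hy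
  rcases lt_or_ge y 0 with hy0 | hy0
  · exact Eventually.of_forall fun p' => hy0.trans_le (sq_nonneg _)
  · have h1 : √y < g p := (Real.sqrt_lt' (lt_of_le_of_ne (h0 p hp) fun h => by
      simp [← h] at hy; linarith)).2 hy
    filter_upwards [hg p hp _ h1] with p' hp'
    calc y = √y ^ 2 := (Real.sq_sqrt hy0).symm
      _ < g p' ^ 2 := by gcongr

/-- The closed unit ball of `ℓ¹(Γ)`, as a set of functions. -/
def l1Ball (Γ : Type*) : Set (Γ → ℝ) := {a | ∀ s : Finset Γ, ∑ γ ∈ s, |a γ| ≤ 1}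

variable {Γ : Type*}

theorem isCompact_l1Ball : IsCompact (l1Ball Γ) := by
  have h : IsCompact (Set.pi Set.univ fun _ : Γ => Set.Icc (-1 : ℝ) 1) :=
    isCompact_univ_pi fun _ => isCompact_Icc
  refine h.of_isClosed_subset ?_ fun a ha γ _ => abs_le.1 (by simpa using ha {γ})
  rw [l1Ball, Set.ofPred_forall]
  exact isClosed_iInter fun s => isClosed_le (by fun_prop) continuous_const

theorem zero_mem_l1Ball : (0 : Γ → ℝ) ∈ l1Ball Γ := fun s => by simp

theorem summable_abs_of_mem_l1Ball {a : Γ → ℝ} (ha : a ∈ l1Ball Γ) : Summable fun γ => |a γ| :=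
  summable_of_sum_le (fun _ => abs_nonneg _) ha

theorem tsum_abs_le_of_mem_l1Ball {a : Γ → ℝ} (ha : a ∈ l1Ball Γ) : ∑' γ, |a γ| ≤ 1 :=
  (summable_abs_of_mem_l1Ball ha).tsum_le_of_sum_le ha

theorem abs_le_one_of_mem_l1Ball {a : Γ → ℝ} (ha : a ∈ l1Ball Γ) (γ : Γ) : |a γ| ≤ 1 := by
  simpa using ha {γ}

theorem sq_le_abs_of_mem_l1Ball {a : Γ → ℝ} (ha : a ∈ l1Ball Γ) (γ : Γ) : a γ ^ 2 ≤ |a γ| := by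
  rw [← sq_abs]
  exact pow_le_of_le_one (abs_nonneg _) (abs_le_one_of_mem_l1Ball ha γ) two_ne_zero

theorem summable_sq_of_mem_l1Ball {a : Γ → ℝ} (ha : a ∈ l1Ball Γ) : Summable fun γ => a γ ^ 2 :=
  (summable_abs_of_mem_l1Ball ha).of_nonneg_of_le (fun _ => sq_nonneg _)
    (sq_le_abs_of_mem_l1Ball ha)

theorem tsum_sq_le_of_mem_l1Ball {a : Γ → ℝ} (ha : a ∈ l1Ball Γ) :
    ∑' γ, a γ ^ 2 ≤ ∑' γ, |a γ| :=
  (summable_sq_of_mem_l1Ball ha).tsum_le_tsum (sq_le_abs_of_mem_l1Ball ha)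
    (summable_abs_of_mem_l1Ball ha)

theorem mem_l1Ball_of_summable {a : Γ → ℝ} (ha : Summable fun γ => |a γ|)
    (h1 : ∑' γ, |a γ| ≤ 1) : a ∈ l1Ball Γ := fun s =>
  (ha.sum_le_tsum s fun _ _ => abs_nonneg _).trans h1

theorem midpoint_mem_l1Ball {a b : Γ → ℝ} (ha : a ∈ l1Ball Γ) (hb : b ∈ l1Ball Γ) :
    (2⁻¹ : ℝ) • (a + b) ∈ l1Ball Γ := by
  intro s
  calc ∑ γ ∈ s, |((2⁻¹ : ℝ) • (a + b)) γ| ≤ ∑ γ ∈ s, 2⁻¹ * (|a γ| + |b γ|) := by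
        refine Finset.sum_le_sum fun γ _ => ?_
        simp only [Pi.smul_apply, Pi.add_apply, smul_eq_mul, abs_mul]
        rw [abs_of_nonneg (by norm_num : (0 : ℝ) ≤ 2⁻¹)]
        gcongr
        exact abs_add_le _ _
    _ = 2⁻¹ * (∑ γ ∈ s, |a γ| + ∑ γ ∈ s, |b γ|) := by
        rw [← Finset.mul_sum, Finset.sum_add_distrib]
    _ ≤ 1 := by linarith [ha s, hb s]

/-- Pointwise convergence together with convergence of the norms implies convergence in `ℓ¹`. -/
theorem tendsto_tsum_abs_sub {a : Γ → ℝ} {b : ℕ → Γ → ℝ} (ha : Summable fun γ => |a γ|)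
    (hb : ∀ k, Summable fun γ => |b k γ|) (hab : ∀ γ, Tendsto (fun k => b k γ) atTop (𝓝 (a γ)))
    (hn : Tendsto (fun k => ∑' γ, |b k γ|) atTop (𝓝 (∑' γ, |a γ|))) :
    Tendsto (fun k => ∑' γ, |b k γ - a γ|) atTop (𝓝 0) := by
  have hd : ∀ k, Summable fun γ => |b k γ - a γ| := fun k =>
    ((hb k).add ha).of_nonneg_of_le (fun _ => abs_nonneg _) fun γ => abs_sub _ _
  have h1 : Tendsto (fun k => ∑' γ, (|a γ| + |b k γ| - |b k γ - a γ|)) atTop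
      (𝓝 (∑' γ, (|a γ| + |a γ| - |a γ - a γ|))) := by
    refine tendsto_tsum_of_dominated_convergence (bound := fun γ => 2 * |a γ|) (ha.mul_left 2)
      (fun γ => ((tendsto_const_nhds.add (hab γ).abs).sub ((hab γ).sub_const _).abs))
      (Eventually.of_forall fun k γ => ?_)
    rw [Real.norm_eq_abs, abs_le]
    have := abs_sub_abs_le_abs_sub (b k γ) (a γ)
    have := abs_sub (b k γ) (a γ)
    constructor <;> linarith [abs_nonneg (a γ)]
  have h2 : ∀ k, ∑' γ, (|a γ| + |b k γ| - |b k γ - a γ|) =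
      ∑' γ, |a γ| + ∑' γ, |b k γ| - ∑' γ, |b k γ - a γ| := fun k => by
    rw [(ha.add (hb k)).tsum_sub (hd k), ha.tsum_add (hb k)]
  simp only [h2, sub_self, abs_zero, sub_zero] at h1
  rw [ha.tsum_add ha] at h1
  have h3 := (tendsto_const_nhds (x := ∑' γ, |a γ|)).add hn |>.sub h1
  simpa using h3

variable {E : Type*} [NormedAddCommGroup E] [NormedSpace ℝ E]

/-- The functional `∑ γ, a γ • F γ`. -/
noncomputable def synth (F : Γ → StrongDual ℝ E) (a : Γ → ℝ) : StrongDual ℝ E := ∑' γ, a γ • F γ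

variable {F : Γ → StrongDual ℝ E}

theorem summable_norm_synth (hF : ∀ γ, ‖F γ‖ ≤ 1) {a : Γ → ℝ} (ha : Summable fun γ => |a γ|) :
    Summable fun γ => ‖a γ • F γ‖ :=
  ha.of_nonneg_of_le (fun _ => norm_nonneg _) fun γ => by
    rw [norm_smul]; exact mul_le_of_le_one_right (abs_nonneg _) (hF γ)

theorem synth_apply (hF : ∀ γ, ‖F γ‖ ≤ 1) {a : Γ → ℝ} (ha : Summable fun γ => |a γ|) (x : E) :
    synth F a x = ∑' γ, a γ * F γ x := by
  have h := (summable_norm_synth hF ha).of_norm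
  exact (ContinuousLinearMap.apply ℝ ℝ x).map_tsum h

theorem norm_synth_le (hF : ∀ γ, ‖F γ‖ ≤ 1) {a : Γ → ℝ} (ha : Summable fun γ => |a γ|) :
    ‖synth F a‖ ≤ ∑' γ, |a γ| :=
  (norm_tsum_le_tsum_norm (summable_norm_synth hF ha)).trans
    ((summable_norm_synth hF ha).tsum_le_tsum (fun γ => by
      rw [norm_smul]; exact mul_le_of_le_one_right (abs_nonneg _) (hF γ)) ha)

theorem synth_sub (hF : ∀ γ, ‖F γ‖ ≤ 1) {a b : Γ → ℝ} (ha : Summable fun γ => |a γ|)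
    (hb : Summable fun γ => |b γ|) : synth F a - synth F b = synth F (a - b) := by
  unfold synth
  rw [← (summable_norm_synth hF ha).of_norm.tsum_sub (summable_norm_synth hF hb).of_norm]
  exact tsum_congr fun γ => (sub_smul _ _ _).symm

theorem synth_add (hF : ∀ γ, ‖F γ‖ ≤ 1) {a b : Γ → ℝ} (ha : Summable fun γ => |a γ|)
    (hb : Summable fun γ => |b γ|) : synth F a + synth F b = synth F (a + b) := by
  unfold synth
  rw [← (summable_norm_synth hF ha).of_norm.tsum_add (summable_norm_synth hF hb).of_norm]
  exact tsum_congr fun γ => (add_smul _ _ _).symm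

theorem synth_smul (c : ℝ) (a : Γ → ℝ) : synth F (c • a) = c • synth F a := by
  unfold synth
  rw [← tsum_const_smul'']
  simp [mul_smul]

theorem synth_zero : synth F 0 = 0 := by simp [synth]

/-- `a ↦ (∑ γ, a γ • F γ) x` is continuous on the unit ball of `ℓ¹` for pointwise convergence. -/
theorem continuousOn_synth_apply (hF : ∀ γ, ‖F γ‖ ≤ 1) {x : E}
    (hx : ∀ ε : ℝ, 0 < ε → {γ | ε ≤ |F γ x|}.Finite) :
    ContinuousOn (fun a => synth F a x) (l1Ball Γ) := by
  refine continuousOn_of_uniform_approx_of_continuousOn fun u hu => ?_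
  obtain ⟨ε, hε, hεu⟩ := Metric.mem_uniformity_dist.1 hu
  set s := (hx (ε / 2) (half_pos hε)).toFinset
  refine ⟨fun a => ∑ γ ∈ s, a γ * F γ x, by fun_prop, fun a ha => hεu ?_⟩
  have hsa := summable_abs_of_mem_l1Ball ha
  have hsum : Summable fun γ => a γ * F γ x :=
    ((summable_norm_synth hF hsa).of_norm.map (ContinuousLinearMap.apply ℝ ℝ x)
      (ContinuousLinearMap.continuous _) :)
  rw [synth_apply hF hsa, ← hsum.sum_add_tsum_compl (s := s), dist_eq_norm, add_sub_cancel_left]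
  have hsc : Summable fun γ : ((s : Set Γ)ᶜ : Set Γ) => |a γ| := hsa.subtype _
  calc ‖∑' γ : ((s : Set Γ)ᶜ : Set Γ), a γ * F γ x‖
      ≤ ∑' γ : ((s : Set Γ)ᶜ : Set Γ), |a γ| * (ε / 2) := by
        refine tsum_of_norm_bounded (hsc.mul_right _).hasSum fun γ => ?_
        rw [norm_mul, Real.norm_eq_abs, Real.norm_eq_abs]
        have h2 : |F γ x| < ε / 2 :=
          not_le.1 fun h => γ.2 ((Set.Finite.mem_toFinset (hx (ε / 2) (half_pos hε))).2 h)
        gcongr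
    _ = (∑' γ : ((s : Set Γ)ᶜ : Set Γ), |a γ|) * (ε / 2) := tsum_mul_right
    _ ≤ 1 * (ε / 2) := by
        gcongr
        refine (hsa.tsum_subtype_le _ _ (fun _ => abs_nonneg _)).trans
          (tsum_abs_le_of_mem_l1Ball ha)
    _ < ε := by linarith

/-- The `n`-th convex penalty, at a functional `f` and coefficients `a`. -/
noncomputable def gaugeTerm (F : Γ → StrongDual ℝ E) (n : ℕ) (f : StrongDual ℝ E) (a : Γ → ℝ) :
    ℝ :=
  ‖f - (n : ℝ) • synth F a‖ ^ 2 + (∑' γ, |a γ|) ^ 2 + ∑' γ, a γ ^ 2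

theorem gaugeTerm_nonneg (n : ℕ) (f : StrongDual ℝ E) (a : Γ → ℝ) : 0 ≤ gaugeTerm F n f a := by
  have : 0 ≤ ∑' γ, a γ ^ 2 := tsum_nonneg fun _ => sq_nonneg _
  unfold gaugeTerm
  positivity

theorem gaugeTerm_le (hF : ∀ γ, ‖F γ‖ ≤ 1) (n : ℕ) {f : StrongDual ℝ E} (hf : ‖f‖ ≤ 1)
    {a : Γ → ℝ} (ha : a ∈ l1Ball Γ) : gaugeTerm F n f a ≤ ((n : ℝ) + 1) ^ 2 + 2 := by
  have hsa := summable_abs_of_mem_l1Ball ha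
  have h1 := tsum_abs_le_of_mem_l1Ball ha
  have h2 := tsum_sq_le_of_mem_l1Ball ha
  have h3 := norm_synth_le hF hsa
  have h0 : 0 ≤ ∑' γ, |a γ| := tsum_nonneg fun _ => abs_nonneg _
  have h4 : ‖f - (n : ℝ) • synth F a‖ ≤ n + 1 := by
    refine (norm_sub_le _ _).trans ?_
    rw [norm_smul, Real.norm_of_nonneg (Nat.cast_nonneg n)]
    have : (n : ℝ) * ‖synth F a‖ ≤ n * 1 :=
      mul_le_mul_of_nonneg_left (h3.trans h1) (Nat.cast_nonneg n)
    linarith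
  have h5 : ‖f - (n : ℝ) • synth F a‖ ^ 2 ≤ ((n : ℝ) + 1) ^ 2 := by gcongr
  have h6 : (∑' γ, |a γ|) ^ 2 ≤ 1 := pow_le_one₀ h0 h1
  unfold gaugeTerm
  linarith

theorem norm_midpoint_sq_le {G : Type*} [NormedAddCommGroup G] [NormedSpace ℝ G] (u v : G) :
    ‖(2⁻¹ : ℝ) • (u + v)‖ ^ 2 + (‖u‖ - ‖v‖) ^ 2 / 4 ≤ (‖u‖ ^ 2 + ‖v‖ ^ 2) / 2 := by
  have h : ‖(2⁻¹ : ℝ) • (u + v)‖ ≤ (‖u‖ + ‖v‖) / 2 := by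
    rw [norm_smul, Real.norm_of_nonneg (by norm_num : (0 : ℝ) ≤ 2⁻¹)]
    linarith [norm_add_le u v]
  have := pow_le_pow_left₀ (norm_nonneg _) h 2
  nlinarith

/-- The convexity gap of the penalty dominates the distances it has to control. -/
theorem gaugeTerm_midpoint_le (hF : ∀ γ, ‖F γ‖ ≤ 1) (n : ℕ) (f g : StrongDual ℝ E) {a b : Γ → ℝ}
    (ha : a ∈ l1Ball Γ) (hb : b ∈ l1Ball Γ) (γ : Γ) :
    gaugeTerm F n ((2⁻¹ : ℝ) • (f + g)) ((2⁻¹ : ℝ) • (a + b)) +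
      ((‖f - (n : ℝ) • synth F a‖ - ‖g - (n : ℝ) • synth F b‖) ^ 2 / 4 +
        (∑' γ, |a γ| - ∑' γ, |b γ|) ^ 2 / 4 + (a γ - b γ) ^ 2 / 4) ≤
      (gaugeTerm F n f a + gaugeTerm F n g b) / 2 := by
  have hsa := summable_abs_of_mem_l1Ball ha
  have hsb := summable_abs_of_mem_l1Ball hb
  have hm := midpoint_mem_l1Ball ha hb
  have hsm := summable_abs_of_mem_l1Ball hm
  have h1 := norm_midpoint_sq_le (f - (n : ℝ) • synth F a) (g - (n : ℝ) • synth F b)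
  have e1 : (2⁻¹ : ℝ) • (f + g) - (n : ℝ) • synth F ((2⁻¹ : ℝ) • (a + b)) =
      (2⁻¹ : ℝ) • ((f - (n : ℝ) • synth F a) + (g - (n : ℝ) • synth F b)) := by
    rw [synth_smul, ← synth_add hF hsa hsb]
    module
  have h2 : ∑' γ, |((2⁻¹ : ℝ) • (a + b)) γ| ≤ (∑' γ, |a γ| + ∑' γ, |b γ|) / 2 := by
    rw [← hsa.tsum_add hsb, ← tsum_div_const]
    refine hsm.tsum_le_tsum (fun γ => ?_) ((hsa.add hsb).div_const 2)
    simp only [Pi.smul_apply, Pi.add_apply, smul_eq_mul, abs_mul]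
    rw [abs_of_nonneg (by norm_num : (0 : ℝ) ≤ 2⁻¹)]
    linarith [abs_add_le (a γ) (b γ)]
  have h2' := pow_le_pow_left₀ (tsum_nonneg fun _ => abs_nonneg _) h2 2
  have hqa := summable_sq_of_mem_l1Ball ha
  have hqb := summable_sq_of_mem_l1Ball hb
  have hqm := summable_sq_of_mem_l1Ball hm
  have hpt : ∀ γ, (a γ ^ 2 + b γ ^ 2) / 2 - ((2⁻¹ : ℝ) • (a + b)) γ ^ 2 = (a γ - b γ) ^ 2 / 4 := by
    intro γ
    simp only [Pi.smul_apply, Pi.add_apply, smul_eq_mul]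
    ring
  have hsd : Summable fun γ => (a γ ^ 2 + b γ ^ 2) / 2 - ((2⁻¹ : ℝ) • (a + b)) γ ^ 2 :=
    ((hqa.add hqb).div_const 2).sub hqm
  have h3 : (a γ - b γ) ^ 2 / 4 ≤
      (∑' γ, a γ ^ 2 + ∑' γ, b γ ^ 2) / 2 - ∑' γ, ((2⁻¹ : ℝ) • (a + b)) γ ^ 2 := by
    rw [← hqa.tsum_add hqb, ← tsum_div_const, ← ((hqa.add hqb).div_const 2).tsum_sub hqm,
      ← hpt γ]
    exact hsd.le_tsum γ fun j _ => by rw [hpt]; positivity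
  unfold gaugeTerm
  rw [e1]
  nlinarith

/-- The weights of the penalties. -/
noncomputable def gaugeWeight (n : ℕ) : ℝ := (1 / 2) ^ n / (((n : ℝ) + 1) ^ 2 + 2)

theorem gaugeWeight_pos (n : ℕ) : 0 < gaugeWeight n := by unfold gaugeWeight; positivity

/-- The weighted sum of all penalties. -/
noncomputable def gaugePenalty (F : Γ → StrongDual ℝ E) (f : StrongDual ℝ E) (a : ℕ → Γ → ℝ) : ℝ :=
  ∑' n, gaugeWeight n * gaugeTerm F n f (a n)

theorem gaugePenalty_nonneg (f : StrongDual ℝ E) (a : ℕ → Γ → ℝ) : 0 ≤ gaugePenalty F f a :=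
  tsum_nonneg fun n => mul_nonneg (gaugeWeight_pos n).le (gaugeTerm_nonneg n f _)

theorem gaugeWeight_mul_gaugeTerm_le (hF : ∀ γ, ‖F γ‖ ≤ 1) (n : ℕ) {f : StrongDual ℝ E}
    (hf : ‖f‖ ≤ 1) {a : Γ → ℝ} (ha : a ∈ l1Ball Γ) :
    gaugeWeight n * gaugeTerm F n f a ≤ (1 / 2) ^ n := by
  have h := gaugeTerm_le hF n hf ha
  unfold gaugeWeight
  rw [div_mul_eq_mul_div, div_le_iff₀ (by positivity)]
  gcongr

theorem summable_gaugePenalty (hF : ∀ γ, ‖F γ‖ ≤ 1) {f : StrongDual ℝ E} (hf : ‖f‖ ≤ 1)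
    {a : ℕ → Γ → ℝ} (ha : ∀ n, a n ∈ l1Ball Γ) :
    Summable fun n => gaugeWeight n * gaugeTerm F n f (a n) :=
  summable_geometric_two.of_nonneg_of_le
    (fun n => mul_nonneg (gaugeWeight_pos n).le (gaugeTerm_nonneg n f _))
    fun n => gaugeWeight_mul_gaugeTerm_le hF n hf (ha n)

theorem gaugePenalty_zero_right_le (f : StrongDual ℝ E) :
    gaugePenalty F f 0 ≤ 2 * ‖f‖ ^ 2 := by
  have h : ∀ n, gaugeWeight n * gaugeTerm F n f ((0 : ℕ → Γ → ℝ) n) ≤ (1 / 2) ^ n * ‖f‖ ^ 2 := by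
    intro n
    have e : gaugeTerm F n f ((0 : ℕ → Γ → ℝ) n) = ‖f‖ ^ 2 := by
      simp [gaugeTerm, synth_zero]
    rw [e]
    gcongr
    unfold gaugeWeight
    refine div_le_self (by positivity) ?_
    nlinarith [sq_nonneg ((n : ℝ) + 1)]
  have hs : Summable fun n : ℕ => (1 / 2 : ℝ) ^ n * ‖f‖ ^ 2 := summable_geometric_two.mul_right _
  calc gaugePenalty F f 0 ≤ ∑' n : ℕ, (1 / 2 : ℝ) ^ n * ‖f‖ ^ 2 :=
        (hs.of_nonneg_of_le (fun n => mul_nonneg (gaugeWeight_pos n).le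
          (gaugeTerm_nonneg n f _)) h).tsum_le_tsum h hs
    _ = 2 * ‖f‖ ^ 2 := by rw [tsum_mul_right, tsum_geometric_two]

end SmoothGauge

section SmoothGauge

variable {Γ : Type*} {E : Type*} [NormedAddCommGroup E] [NormedSpace ℝ E]
  {F : Γ → StrongDual ℝ E}

theorem lowerSemicontinuousOn_gaugePenalty (hF : ∀ γ, ‖F γ‖ ≤ 1)
    (hF0 : ∀ (x : E) (ε : ℝ), 0 < ε → {γ | ε ≤ |F γ x|}.Finite) :
    LowerSemicontinuousOn
      (fun p : WeakDual ℝ E × (ℕ → Γ → ℝ) => gaugePenalty F (WeakDual.toStrongDual p.1) p.2)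
      ((WeakDual.toStrongDual ⁻¹' Metric.closedBall (0 : StrongDual ℝ E) 1) ×ˢ
        Set.pi Set.univ fun _ => l1Ball Γ) := by
  set K := (WeakDual.toStrongDual ⁻¹' Metric.closedBall (0 : StrongDual ℝ E) 1) ×ˢ
        (Set.pi Set.univ fun _ : ℕ => l1Ball Γ) with hK
  have hball : ∀ p ∈ K, ∀ n, p.2 n ∈ l1Ball Γ := fun p hp n => hp.2 n (Set.mem_univ n)
  have hnorm : ∀ p ∈ K, ‖WeakDual.toStrongDual p.1‖ ≤ 1 := fun p hp => by simpa using hp.1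
  refine lowerSemicontinuousOn_tsum_of_nonneg
    (fun n p _ => mul_nonneg (gaugeWeight_pos n).le (gaugeTerm_nonneg n _ _))
    (fun p hp => summable_gaugePenalty hF (hnorm p hp) (hball p hp)) fun n => ?_
  have hcoord : ∀ γ, Continuous fun p : WeakDual ℝ E × (ℕ → Γ → ℝ) => p.2 n γ := fun γ => by
    fun_prop
  have h1 : LowerSemicontinuousOn (fun p : WeakDual ℝ E × (ℕ → Γ → ℝ) =>
      ‖WeakDual.toStrongDual p.1 - (n : ℝ) • synth F (p.2 n)‖) K := by
    intro p hp y hy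
    rcases lt_or_ge y 0 with hy0 | hy0
    · exact Eventually.of_forall fun p' => hy0.trans_le (norm_nonneg _)
    obtain ⟨x, hx, hyx⟩ := ContinuousLinearMap.exists_lt_apply_of_lt_opNorm _ hy
    have hc : ContinuousOn (fun p : WeakDual ℝ E × (ℕ → Γ → ℝ) =>
        ‖(WeakDual.toStrongDual p.1 - (n : ℝ) • synth F (p.2 n)) x‖) K := by
      have hc1 : ContinuousOn (fun p : WeakDual ℝ E × (ℕ → Γ → ℝ) => p.1 x) K :=
        ((WeakDual.eval_continuous x).comp continuous_fst).continuousOn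
      have hc2 : ContinuousOn (fun p : WeakDual ℝ E × (ℕ → Γ → ℝ) => synth F (p.2 n) x) K :=
        (continuousOn_synth_apply hF (hF0 x)).comp (by fun_prop) fun p hp => hball p hp n
      exact (hc1.sub (hc2.const_smul (n : ℝ))).norm
    filter_upwards [(hc p hp).eventually (lt_mem_nhds hyx)] with p' hp'
    refine hp'.trans_le ((ContinuousLinearMap.le_opNorm _ x).trans ?_)
    exact mul_le_of_le_one_right (norm_nonneg _) hx.le
  have h2 : LowerSemicontinuousOn (fun p : WeakDual ℝ E × (ℕ → Γ → ℝ) =>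
      ∑' γ, |p.2 n γ|) K :=
    lowerSemicontinuousOn_tsum_of_nonneg (fun _ _ _ => abs_nonneg _)
      (fun p hp => summable_abs_of_mem_l1Ball (hball p hp n))
      fun γ => (hcoord γ).abs.lowerSemicontinuous.lowerSemicontinuousOn _
  have h3 : LowerSemicontinuousOn (fun p : WeakDual ℝ E × (ℕ → Γ → ℝ) =>
      ∑' γ, p.2 n γ ^ 2) K :=
    lowerSemicontinuousOn_tsum_of_nonneg (fun _ _ _ => sq_nonneg _)
      (fun p hp => summable_sq_of_mem_l1Ball (hball p hp n))
      fun γ => ((hcoord γ).pow 2).lowerSemicontinuous.lowerSemicontinuousOn _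
  have h4 := ((h1.sq_of_nonneg fun _ _ => norm_nonneg _).add
    (h2.sq_of_nonneg fun _ _ => tsum_nonneg fun _ => abs_nonneg _)).add h3
  exact (continuous_const_mul (gaugeWeight n)).comp_lowerSemicontinuousOn h4
    fun u v huv => mul_le_mul_of_nonneg_left huv (gaugeWeight_pos n).le

theorem exists_gauge_minimizer (hF : ∀ γ, ‖F γ‖ ≤ 1)
    (hF0 : ∀ (x : E) (ε : ℝ), 0 < ε → {γ | ε ≤ |F γ x|}.Finite) (x : E) :
    ∃ (f : StrongDual ℝ E) (a : ℕ → Γ → ℝ), ‖f‖ ≤ 1 ∧ (∀ n, a n ∈ l1Ball Γ) ∧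
      ∀ (g : StrongDual ℝ E) (b : ℕ → Γ → ℝ), ‖g‖ ≤ 1 → (∀ n, b n ∈ l1Ball Γ) →
        gaugePenalty F f a - f x ≤ gaugePenalty F g b - g x := by
  have hK : IsCompact ((WeakDual.toStrongDual ⁻¹' Metric.closedBall (0 : StrongDual ℝ E) 1) ×ˢ
        Set.pi Set.univ fun _ : ℕ => l1Ball Γ) :=
    (WeakDual.isCompact_closedBall _ _).prod (isCompact_univ_pi fun _ => isCompact_l1Ball)
  have hc : Continuous fun p : WeakDual ℝ E × (ℕ → Γ → ℝ) => -p.1 x :=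
    ((WeakDual.eval_continuous x).comp continuous_fst).neg
  have hl := (lowerSemicontinuousOn_gaugePenalty hF hF0).add
    (hc.lowerSemicontinuous.lowerSemicontinuousOn _)
  have hne : ((WeakDual.toStrongDual ⁻¹' Metric.closedBall (0 : StrongDual ℝ E) 1) ×ˢ
        Set.pi Set.univ fun _ : ℕ => l1Ball Γ).Nonempty :=
    ⟨(0, 0), by simp, fun _ _ => zero_mem_l1Ball⟩
  obtain ⟨p, hp, hmin⟩ := hl.exists_isMinOn hne hK
  refine ⟨WeakDual.toStrongDual p.1, p.2, by simpa using hp.1, fun n => hp.2 n (Set.mem_univ n),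
    fun g b hg hb => ?_⟩
  have := hmin (show (StrongDual.toWeakDual g, b) ∈ _ from ⟨by simpa using hg, fun n _ => hb n⟩)
  simpa [sub_eq_add_neg] using this

theorem dense_span_of_total (hE : IsReflexiveSpace E)
    (hF1 : ∀ x : E, (∀ γ, F γ x = 0) → x = 0) (f : StrongDual ℝ E) {ε : ℝ} (hε : 0 < ε) :
    ∃ c : Γ →₀ ℝ, ‖f - synth F c‖ < ε := by
  have hf : f ∈ (Submodule.span ℝ (Set.range F)).topologicalClosure := by
    by_contra h
    obtain ⟨Ξ, hΞ, hΞf⟩ :=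
      exists_dual_eq_zero_of_notMem (Submodule.isClosed_topologicalClosure _) h
    obtain ⟨x, rfl⟩ := hE Ξ
    have : x = 0 := hF1 x fun γ => by
      simpa using hΞ (F γ) (subset_closure (Submodule.subset_span ⟨γ, rfl⟩))
    simp [this] at hΞf
  obtain ⟨g, hg, hfg⟩ := Metric.mem_closure_iff.1 hf ε hε
  obtain ⟨c, rfl⟩ := (Finsupp.mem_span_range_iff_exists_finsupp).1 hg
  refine ⟨c, ?_⟩
  rw [dist_eq_norm] at hfg
  have e : synth F c = c.sum fun γ t => t • F γ :=
    tsum_eq_sum fun γ hγ => by rw [Finsupp.notMem_support_iff.1 hγ, zero_smul]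
  rwa [e]

theorem gaugeTerm_le_of_minimizer (hF : ∀ γ, ‖F γ‖ ≤ 1) {x : E} {f : StrongDual ℝ E}
    {a : ℕ → Γ → ℝ} (hf : ‖f‖ ≤ 1) (ha : ∀ n, a n ∈ l1Ball Γ)
    (hmin : ∀ (g : StrongDual ℝ E) (b : ℕ → Γ → ℝ), ‖g‖ ≤ 1 → (∀ n, b n ∈ l1Ball Γ) →
        gaugePenalty F f a - f x ≤ gaugePenalty F g b - g x) (n : ℕ) {b : Γ → ℝ}
    (hb : b ∈ l1Ball Γ) : gaugeTerm F n f (a n) ≤ gaugeTerm F n f b := by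
  classical
  by_contra! hlt
  have hmem : ∀ m, Function.update a n b m ∈ l1Ball Γ := by
    intro m
    rcases eq_or_ne m n with rfl | h
    · simpa using hb
    · simpa [h] using ha m
  have h1 := hmin f (Function.update a n b) hf hmem
  have h2 : gaugePenalty F f (Function.update a n b) < gaugePenalty F f a := by
    refine Summable.tsum_lt_tsum (i := n) (fun m => ?_) ?_ (summable_gaugePenalty hF hf hmem)
      (summable_gaugePenalty hF hf ha)
    · rcases eq_or_ne m n with rfl | h
      · simpa using mul_le_mul_of_nonneg_left hlt.le (gaugeWeight_pos m).le
      · simp [h]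
    · simpa using mul_lt_mul_of_pos_left hlt (gaugeWeight_pos n)
  linarith

theorem exists_norm_sub_synth_lt_of_minimizer (hE : IsReflexiveSpace E) (hF : ∀ γ, ‖F γ‖ ≤ 1)
    (hF1 : ∀ x : E, (∀ γ, F γ x = 0) → x = 0) {x : E} {f : StrongDual ℝ E}
    {a : ℕ → Γ → ℝ} (hf : ‖f‖ ≤ 1) (ha : ∀ n, a n ∈ l1Ball Γ)
    (hmin : ∀ (g : StrongDual ℝ E) (b : ℕ → Γ → ℝ), ‖g‖ ≤ 1 → (∀ n, b n ∈ l1Ball Γ) →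
        gaugePenalty F f a - f x ≤ gaugePenalty F g b - g x) {ε : ℝ} (hε : 0 < ε) :
    ∃ n : ℕ, ‖f - (n : ℝ) • synth F (a n)‖ < ε := by
  obtain ⟨c, hc⟩ := dense_span_of_total hE hF1 f (half_pos hε)
  have hsc : Summable fun γ => |c γ| :=
    summable_of_ne_finset_zero (s := c.support) fun γ hγ => by
      simp [Finsupp.notMem_support_iff.1 hγ]
  set C := ∑' γ, |c γ| with hC
  have hC0 : 0 ≤ C := tsum_nonneg fun _ => abs_nonneg _
  obtain ⟨n, hn⟩ := exists_nat_gt (max (max C 1) (2 * C / ε))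
  have hnC : C < n := ((le_max_left _ _).trans (le_max_left _ _)).trans_lt hn
  have hn1 : (1 : ℝ) < n := ((le_max_right _ _).trans (le_max_left _ _)).trans_lt hn
  have hnε : 2 * C / ε < n := (le_max_right _ _).trans_lt hn
  have hn0 : (0 : ℝ) < n := by linarith
  have habs : ∀ γ, |((n : ℝ)⁻¹ • (c : Γ → ℝ)) γ| = (n : ℝ)⁻¹ * |c γ| := fun γ => by
    simp [abs_mul]
  have hsum : ∑' γ, |((n : ℝ)⁻¹ • (c : Γ → ℝ)) γ| = (n : ℝ)⁻¹ * C := by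
    simp only [habs, tsum_mul_left, hC]
  have hb : (n : ℝ)⁻¹ • (c : Γ → ℝ) ∈ l1Ball Γ := by
    refine mem_l1Ball_of_summable ?_ ?_
    · simp only [habs]; exact hsc.mul_left _
    · rw [hsum, inv_mul_le_one₀ hn0]; exact hnC.le
  refine ⟨n, ?_⟩
  have h1 := gaugeTerm_le_of_minimizer hF hf ha hmin n hb
  have h2 : ‖f - (n : ℝ) • synth F (a n)‖ ^ 2 ≤ gaugeTerm F n f (a n) := by
    have : 0 ≤ ∑' γ, a n γ ^ 2 := tsum_nonneg fun _ => sq_nonneg _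
    unfold gaugeTerm
    nlinarith [sq_nonneg (∑' γ, |a n γ|)]
  have hδ : (n : ℝ)⁻¹ * C < ε / 2 := by
    rw [inv_mul_eq_div, div_lt_iff₀ hn0]
    rw [div_lt_iff₀ hε] at hnε
    linarith
  have hδ0 : 0 ≤ (n : ℝ)⁻¹ * C := by positivity
  have h3 : ∑' γ, ((n : ℝ)⁻¹ • (c : Γ → ℝ)) γ ^ 2 ≤ ((n : ℝ)⁻¹ * C) ^ 2 := by
    have hsb := summable_abs_of_mem_l1Ball hb
    calc ∑' γ, ((n : ℝ)⁻¹ • (c : Γ → ℝ)) γ ^ 2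
        ≤ ∑' γ, |((n : ℝ)⁻¹ • (c : Γ → ℝ)) γ| * ((n : ℝ)⁻¹ * C) := by
          refine (summable_sq_of_mem_l1Ball hb).tsum_le_tsum (fun γ => ?_) (hsb.mul_right _)
          rw [← sq_abs, sq]
          gcongr
          rw [← hsum]
          exact hsb.le_tsum γ fun _ _ => abs_nonneg _
      _ = ((n : ℝ)⁻¹ * C) ^ 2 := by rw [tsum_mul_right, hsum, sq]
  have h4 : gaugeTerm F n f ((n : ℝ)⁻¹ • (c : Γ → ℝ)) < ε ^ 2 := by
    unfold gaugeTerm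
    rw [synth_smul, smul_inv_smul₀ hn0.ne', hsum]
    have h5 : ‖f - synth F c‖ ^ 2 < (ε / 2) ^ 2 := by gcongr
    have h6 : ((n : ℝ)⁻¹ * C) ^ 2 < (ε / 2) ^ 2 := by gcongr
    nlinarith
  exact lt_of_pow_lt_pow_left₀ 2 hε.le (h2.trans_lt (h1.trans_lt h4))

/-- Minimizing sequences of the penalized problem converge in norm. -/
theorem tendsto_of_minimizing (hE : IsReflexiveSpace E) (hF : ∀ γ, ‖F γ‖ ≤ 1)
    (hF1 : ∀ x : E, (∀ γ, F γ x = 0) → x = 0) {x : E} {f : StrongDual ℝ E}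
    {a : ℕ → Γ → ℝ} (hf : ‖f‖ ≤ 1) (ha : ∀ n, a n ∈ l1Ball Γ)
    (hmin : ∀ (g : StrongDual ℝ E) (b : ℕ → Γ → ℝ), ‖g‖ ≤ 1 → (∀ n, b n ∈ l1Ball Γ) →
        gaugePenalty F f a - f x ≤ gaugePenalty F g b - g x)
    {g : ℕ → StrongDual ℝ E} {b : ℕ → ℕ → Γ → ℝ} (hg : ∀ k, ‖g k‖ ≤ 1)
    (hb : ∀ k n, b k n ∈ l1Ball Γ)
    (hgb : Tendsto (fun k => gaugePenalty F (g k) (b k) - g k x) atTop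
      (𝓝 (gaugePenalty F f a - f x))) :
    Tendsto g atTop (𝓝 f) := by
  have hgap : ∀ (k n : ℕ) (γ : Γ), gaugeWeight n *
      ((‖f - (n : ℝ) • synth F (a n)‖ - ‖g k - (n : ℝ) • synth F (b k n)‖) ^ 2 / 4 +
        (∑' γ, |a n γ| - ∑' γ, |b k n γ|) ^ 2 / 4 + (a n γ - b k n γ) ^ 2 / 4) ≤
      ((gaugePenalty F (g k) (b k) - g k x) - (gaugePenalty F f a - f x)) / 2 := by
    intro k n γ
    have hmf : ‖(2⁻¹ : ℝ) • (f + g k)‖ ≤ 1 := by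
      rw [norm_smul, Real.norm_of_nonneg (by norm_num : (0 : ℝ) ≤ 2⁻¹)]
      linarith [norm_add_le f (g k), hg k]
    have hma : ∀ n, (2⁻¹ : ℝ) • (a n + b k n) ∈ l1Ball Γ := fun n =>
      midpoint_mem_l1Ball (ha n) (hb k n)
    have h1 := hmin ((2⁻¹ : ℝ) • (f + g k)) (fun n => (2⁻¹ : ℝ) • (a n + b k n)) hmf hma
    have e1 : ((2⁻¹ : ℝ) • (f + g k)) x = (f x + g k x) / 2 := by
      change 2⁻¹ * (f x + g k x) = _
      ring
    have hs1 := summable_gaugePenalty hF hf ha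
    have hs2 := summable_gaugePenalty hF (hg k) (hb k)
    have hs3 := summable_gaugePenalty hF hmf hma
    have hsd := ((hs1.add hs2).div_const 2).sub hs3
    have hle : ∀ m (γ : Γ), gaugeWeight m *
      ((‖f - (m : ℝ) • synth F (a m)‖ - ‖g k - (m : ℝ) • synth F (b k m)‖) ^ 2 / 4 +
        (∑' γ, |a m γ| - ∑' γ, |b k m γ|) ^ 2 / 4 + (a m γ - b k m γ) ^ 2 / 4) ≤
        (gaugeWeight m * gaugeTerm F m f (a m) + gaugeWeight m * gaugeTerm F m (g k) (b k m)) / 2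
        - gaugeWeight m * gaugeTerm F m ((2⁻¹ : ℝ) • (f + g k)) ((2⁻¹ : ℝ) • (a m + b k m)) := by
      intro m γ
      have := mul_le_mul_of_nonneg_left
        (gaugeTerm_midpoint_le hF m f (g k) (ha m) (hb k m) γ) (gaugeWeight_pos m).le
      linarith
    have h2 := (hle n γ).trans (hsd.le_tsum n fun m _ =>
      (mul_nonneg (gaugeWeight_pos m).le (by positivity)).trans (hle m γ))
    rw [((hs1.add hs2).div_const 2).tsum_sub hs3, tsum_div_const, hs1.tsum_add hs2] at h2
    change _ ≤ (gaugePenalty F f a + gaugePenalty F (g k) (b k)) / 2 -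
      gaugePenalty F ((2⁻¹ : ℝ) • (f + g k)) (fun n => (2⁻¹ : ℝ) • (a n + b k n)) at h2
    rw [e1] at h1
    linarith
  obtain ⟨D, hD, hgap'⟩ : ∃ D : ℕ → ℕ → ℝ, (∀ n, Tendsto (fun k => D k n) atTop (𝓝 0)) ∧
      ∀ (k n : ℕ) (γ : Γ),
      (‖f - (n : ℝ) • synth F (a n)‖ - ‖g k - (n : ℝ) • synth F (b k n)‖) ^ 2 / 4 +
        (∑' γ, |a n γ| - ∑' γ, |b k n γ|) ^ 2 / 4 + (a n γ - b k n γ) ^ 2 / 4 ≤ D k n := by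
    refine ⟨fun k n => ((gaugePenalty F (g k) (b k) - g k x) -
      (gaugePenalty F f a - f x)) / 2 / gaugeWeight n, fun n => ?_, fun k n γ => ?_⟩
    · simpa using ((hgb.sub_const (gaugePenalty F f a - f x)).div_const 2).div_const
        (gaugeWeight n)
    · rw [le_div_iff₀' (gaugeWeight_pos n)]
      exact hgap k n γ
  rcases isEmpty_or_nonempty Γ with hΓ | ⟨⟨γ₀⟩⟩
  · have hsub : ∀ x : E, x = 0 := fun x => hF1 x fun γ => hΓ.elim γ
    have : ∀ h : StrongDual ℝ E, h = f := fun h => by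
      ext x
      simp [hsub x]
    exact tendsto_const_nhds.congr fun k => (this (g k)).symm
  have sq_lim : ∀ {s : ℕ → ℝ} {n : ℕ}, (∀ k, s k ^ 2 ≤ 4 * D k n) →
      Tendsto s atTop (𝓝 0) := by
    intro s n hs
    have h1 : Tendsto (fun k => s k ^ 2) atTop (𝓝 0) :=
      squeeze_zero (fun k => sq_nonneg _) hs (by simpa using (hD n).const_mul 4)
    have h2 := (Real.continuous_sqrt.tendsto 0).comp h1
    rw [Real.sqrt_zero] at h2
    refine tendsto_zero_iff_abs_tendsto_zero s |>.2 (h2.congr fun k => ?_)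
    simp [Real.sqrt_sq_eq_abs]
  refine Metric.tendsto_atTop'.2 fun ε hε => ?_
  obtain ⟨n, hn⟩ := exists_norm_sub_synth_lt_of_minimizer hE hF hF1 hf ha hmin
    (show 0 < ε / 4 by positivity)
  have hA : Tendsto (fun k => ‖f - (n : ℝ) • synth F (a n)‖ -
      ‖g k - (n : ℝ) • synth F (b k n)‖) atTop (𝓝 0) := sq_lim fun k => by
    linarith [hgap' k n γ₀, sq_nonneg (∑' γ, |a n γ| - ∑' γ, |b k n γ|),
      sq_nonneg (a n γ₀ - b k n γ₀)]
  have hα : Tendsto (fun k => ∑' γ, |a n γ| - ∑' γ, |b k n γ|) atTop (𝓝 0) := sq_lim fun k => by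
    linarith [hgap' k n γ₀, sq_nonneg (a n γ₀ - b k n γ₀), sq_nonneg
      (‖f - (n : ℝ) • synth F (a n)‖ - ‖g k - (n : ℝ) • synth F (b k n)‖)]
  have hpt : ∀ γ, Tendsto (fun k => a n γ - b k n γ) atTop (𝓝 0) := fun γ => sq_lim fun k => by
    linarith [hgap' k n γ, sq_nonneg (∑' γ, |a n γ| - ∑' γ, |b k n γ|), sq_nonneg
      (‖f - (n : ℝ) • synth F (a n)‖ - ‖g k - (n : ℝ) • synth F (b k n)‖)]
  have hsa := summable_abs_of_mem_l1Ball (ha n)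
  have hsb := fun k => summable_abs_of_mem_l1Ball (hb k n)
  have hl1 := tendsto_tsum_abs_sub (b := fun k => b k n) hsa hsb
    (fun γ => by simpa using (tendsto_const_nhds (x := a n γ)).sub (hpt γ))
    (by simpa using (tendsto_const_nhds (x := ∑' γ, |a n γ|)).sub hα)
  have hl1' : Tendsto (fun k => (n : ℝ) * ∑' γ, |b k n γ - a n γ|) atTop (𝓝 0) := by
    simpa using hl1.const_mul (n : ℝ)
  have ev1 := hA.eventually (lt_mem_nhds (show -(ε / 4) < 0 by linarith))
  have ev2 := hl1'.eventually (gt_mem_nhds (show 0 < ε / 4 by linarith))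
  obtain ⟨N, hN⟩ := (ev1.and ev2).exists_forall_of_atTop
  refine ⟨N, fun k hk => ?_⟩
  obtain ⟨h1, h2⟩ := hN k hk.le
  rw [dist_eq_norm]
  have hsd : Summable fun γ => |(b k n - a n) γ| :=
    ((hsb k).add hsa).of_nonneg_of_le (fun _ => abs_nonneg _) fun γ => abs_sub _ _
  have h3 : ‖(n : ℝ) • (synth F (b k n) - synth F (a n))‖ ≤ n * ∑' γ, |b k n γ - a n γ| := by
    rw [norm_smul, Real.norm_of_nonneg (Nat.cast_nonneg n), synth_sub hF (hsb k) hsa]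
    exact mul_le_mul_of_nonneg_left (norm_synth_le hF hsd) (Nat.cast_nonneg n)
  have e : g k - f = (g k - (n : ℝ) • synth F (b k n)) +
      (n : ℝ) • (synth F (b k n) - synth F (a n)) - (f - (n : ℝ) • synth F (a n)) := by
    module
  have h4 := norm_sub_le ((g k - (n : ℝ) • synth F (b k n)) +
      (n : ℝ) • (synth F (b k n) - synth F (a n))) (f - (n : ℝ) • synth F (a n))
  have h5 := norm_add_le (g k - (n : ℝ) • synth F (b k n))
      ((n : ℝ) • (synth F (b k n) - synth F (a n)))
  rw [e]
  linarith

/-- A reflexive space carries a `C¹` function with bounded derivative that is comparable to the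
square of the norm near the origin and to the norm at infinity. -/
theorem IsReflexiveSpace.exists_smooth_gauge [CompleteSpace E] (hE : IsReflexiveSpace E) :
    ∃ θ : E → ℝ, ContDiff ℝ 1 θ ∧ θ 0 = 0 ∧ (∀ x, 0 ≤ θ x) ∧ (∀ x, ‖fderiv ℝ θ x‖ ≤ 1) ∧
      ∀ (x : E) (s : ℝ), 0 ≤ s → s ≤ 1 → s * ‖x‖ - 2 * s ^ 2 ≤ θ x := by
  obtain ⟨F₀, hF₀, htot⟩ := hE.exists_isNullFamily
  let F : F₀ → StrongDual ℝ E := Subtype.val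
  have hF : ∀ γ, ‖F γ‖ ≤ 1 := fun γ => hF₀.norm_le γ.1 γ.2
  have hF0 : ∀ (x : E) (ε : ℝ), 0 < ε → {γ | ε ≤ |F γ x|}.Finite := fun x ε hε => by
    refine Set.Finite.of_finite_image ((hF₀.finite x ε hε).subset ?_)
      (Subtype.val_injective.injOn)
    rintro _ ⟨γ, hγ, rfl⟩
    exact ⟨γ.2, hγ⟩
  have hF1 : ∀ x : E, (∀ γ, F γ x = 0) → x = 0 := fun x hx =>
    htot x fun f hf => hx ⟨f, hf⟩
  choose f a hf ha hmin using exists_gauge_minimizer hF hF0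
  let θ : E → ℝ := fun x => f x x - gaugePenalty F (f x) (a x)
  have hθ : ∀ x, θ x = f x x - gaugePenalty F (f x) (a x) := fun x => rfl
  have hge : ∀ x (g : StrongDual ℝ E) (b : ℕ → F₀ → ℝ), ‖g‖ ≤ 1 → (∀ n, b n ∈ l1Ball F₀) →
      g x - gaugePenalty F g b ≤ θ x := fun x g b hg hb => by
    have := hmin x g b hg hb
    rw [hθ]
    linarith
  have hdiff : ∀ x y, f y (x - y) ≤ θ x - θ y := fun x y => by
    have := hge x (f y) (a y) (hf y) (ha y)
    rw [map_sub, hθ y]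
    linarith
  have hf_le : ∀ y x, |f y x| ≤ ‖x‖ := fun y x =>
    ((f y).le_opNorm x).trans (mul_le_of_le_one_left (norm_nonneg _) (hf y))
  have hlip : ∀ x y, |θ x - θ y| ≤ ‖x - y‖ := fun x y => by
    have h1 := hdiff x y
    have h2 := hdiff y x
    have h3 := abs_le.1 (hf_le y (x - y))
    have h4 := abs_le.1 (hf_le x (y - x))
    rw [norm_sub_rev y x] at h4
    rw [abs_le]
    constructor <;> linarith
  have hcont : Continuous f := by
    refine continuous_iff_seqContinuous.2 fun u x hu => ?_
    refine tendsto_of_minimizing hE hF hF1 (hf x) (ha x) (hmin x) (fun k => hf (u k))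
      (fun k => ha (u k)) ?_
    have e : ∀ k, gaugePenalty F (f (u k)) (a (u k)) - f (u k) x =
        f (u k) (u k - x) - (θ (u k) - θ x) + (gaugePenalty F (f x) (a x) - f x x) := by
      intro k
      rw [hθ, hθ, map_sub]
      ring
    simp only [Function.comp_def, e]
    have hux : Tendsto (fun k => ‖u k - x‖) atTop (𝓝 0) := tendsto_iff_norm_sub_tendsto_zero.1 hu
    have l1 : Tendsto (fun k => f (u k) (u k - x)) atTop (𝓝 0) :=
      squeeze_zero_norm (fun k => hf_le _ _) hux
    have l2 : Tendsto (fun k => θ (u k) - θ x) atTop (𝓝 0) :=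
      squeeze_zero_norm (fun k => hlip _ _) hux
    simpa using (l1.sub l2).add_const (gaugePenalty F (f x) (a x) - f x x)
  have hderiv : ∀ x, HasFDerivAt θ (f x) x := by
    intro x
    rw [hasFDerivAt_iff_isLittleO, Asymptotics.isLittleO_iff]
    intro c hc
    have hev : ∀ᶠ y in 𝓝 x, ‖f y - f x‖ < c := by
      have := (tendsto_iff_norm_sub_tendsto_zero.1 (hcont.tendsto x))
      exact this.eventually (gt_mem_nhds hc)
    filter_upwards [hev] with y hy
    have h1 := hdiff y x
    have h2 := hdiff x y
    have h3 : (f y - f x) (y - x) ≤ c * ‖y - x‖ :=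
      ((le_abs_self _).trans ((f y - f x).le_opNorm _)).trans (by gcongr)
    have e1 : (f y - f x) (y - x) = f y (y - x) - f x (y - x) := rfl
    have e2 : f y (x - y) = -f y (y - x) := by rw [← map_neg, neg_sub]
    rw [Real.norm_eq_abs, abs_of_nonneg (by linarith)]
    linarith
  have hfd : fderiv ℝ θ = f := funext fun x => (hderiv x).fderiv
  refine ⟨θ, ?_, ?_, ?_, ?_, ?_⟩
  · rw [contDiff_one_iff_fderiv, hfd]
    exact ⟨fun x => (hderiv x).differentiableAt, hcont⟩
  · refine le_antisymm ?_ ?_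
    · rw [hθ, map_zero]
      linarith [gaugePenalty_nonneg (F := F) (f 0) (a 0)]
    · have := hge 0 0 0 (by simp) fun _ => zero_mem_l1Ball
      have h2 := gaugePenalty_zero_right_le (F := F) 0
      simp at this h2
      linarith
  · intro x
    have := hge x 0 0 (by simp) fun _ => zero_mem_l1Ball
    have h2 := gaugePenalty_zero_right_le (F := F) 0
    simp at this h2
    linarith
  · intro x
    rw [hfd]
    exact hf x
  · intro x s hs0 hs1
    have hn : ‖s • normingFunctional x‖ ≤ s := by
      rw [norm_smul, Real.norm_of_nonneg hs0]
      exact mul_le_of_le_one_right hs0 (norm_normingFunctional_le x)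
    have h1 := hge x (s • normingFunctional x) 0 (hn.trans hs1) fun _ => zero_mem_l1Ball
    have h2 := gaugePenalty_zero_right_le (F := F) (s • normingFunctional x)
    have h3 : ‖s • normingFunctional x‖ ^ 2 ≤ s ^ 2 := by gcongr
    have e : (s • normingFunctional x) x = s * ‖x‖ := by
      change s * normingFunctional x x = _
      rw [normingFunctional_apply]
    rw [e] at h1
    linarith

end SmoothGauge

section VariationalPrinciple

theorem exists_near_minimizer {X : Type*} {h : X → ℝ} (hb : BddBelow (Set.range h)) (x : X)
    {η : ℝ} (hη : 0 < η) : ∃ y, h y ≤ h x ∧ ∀ z, h y ≤ h z + η := by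
  have hne : (Set.range h).Nonempty := ⟨_, x, rfl⟩
  obtain ⟨_, ⟨y, rfl⟩, hy⟩ := exists_lt_of_csInf_lt hne (lt_add_of_pos_right (sInf (Set.range h)) hη)
  have hinf : ∀ z, sInf (Set.range h) ≤ h z := fun z => csInf_le hb ⟨z, rfl⟩
  rcases le_total (h y) (h x) with hyx | hyx
  · exact ⟨y, hyx, fun z => by linarith [hinf z]⟩
  · exact ⟨x, le_rfl, fun z => by linarith [hinf z]⟩

/-- A variational principle of Borwein–Preiss type for a bounded gauge `ρ`. -/
theorem exists_minimizer_of_gauge {X : Type*} [PseudoMetricSpace X] [CompleteSpace X] {f : X → ℝ}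
    (hf : Continuous f) (hb : BddBelow (Set.range f)) {ρ : X → X → ℝ}
    (hρc : ∀ y, Continuous fun x => ρ x y) (hρ0 : ∀ x, ρ x x = 0) (hρn : ∀ x y, 0 ≤ ρ x y)
    (hρ1 : ∀ x y, ρ x y ≤ 1) (hρd : ∀ ε : ℝ, 0 < ε → ∃ δ > 0, ∀ x y, ρ x y < δ → dist x y < ε)
    (x₀ : X) {ε : ℝ} (hε : 0 < ε) :
    ∃ (u : ℕ → X) (y : X), f y + ∑' i, ε * (1 / 2) ^ i * ρ y (u i) ≤ f x₀ ∧
      ∀ x, f y + ∑' i, ε * (1 / 2) ^ i * ρ y (u i) ≤ f x + ∑' i, ε * (1 / 2) ^ i * ρ x (u i) := by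
  set δ : ℕ → ℝ := fun i => ε * (1 / 2) ^ i with hδ
  have hδ0 : ∀ i, 0 < δ i := fun i => by positivity
  have hδs : Summable δ := summable_geometric_two.mul_left ε
  choose d hd0 hd using fun i : ℕ => hρd ((1 / 2) ^ i) (by positivity)
  set η : ℕ → ℝ := fun i => min (δ i * d i / 2) ((1 / 2) ^ i) with hη
  have hη0 : ∀ i, 0 < η i := fun i =>
    lt_min (by have := hδ0 i; have := hd0 i; positivity) (by positivity)
  have hη1 : ∀ i, η i ≤ δ i * d i / 2 := fun i => min_le_left _ _
  have hηlim : Tendsto η atTop (𝓝 0) :=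
    squeeze_zero (fun i => (hη0 i).le) (fun i => min_le_right _ _)
      (tendsto_pow_atTop_nhds_zero_of_lt_one (by norm_num) (by norm_num))
  have hch : ∀ (h : X → ℝ) (x : X) (i : ℕ), ∃ y, BddBelow (Set.range h) →
      h y ≤ h x ∧ ∀ z, h y ≤ h z + η i := fun h x i => by
    by_cases hh : BddBelow (Set.range h)
    · obtain ⟨y, hy⟩ := exists_near_minimizer hh x (hη0 i)
      exact ⟨y, fun _ => hy⟩
    · exact ⟨x, fun h' => absurd h' hh⟩
  choose next hnext using hch
  let S : ℕ → (X → ℝ) × X := fun n => Nat.rec (f, next f x₀ 0)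
    (fun i p => (fun x => p.1 x + δ i * ρ x p.2,
      next (fun x => p.1 x + δ i * ρ x p.2) p.2 (i + 1))) n
  set h : ℕ → X → ℝ := fun i => (S i).1 with hh
  set u : ℕ → X := fun i => (S i).2 with hu
  have hsucc : ∀ i x, h (i + 1) x = h i x + δ i * ρ x (u i) := fun i x => rfl
  have hmono : ∀ i x, h i x ≤ h (i + 1) x := fun i x => by
    rw [hsucc]
    exact le_add_of_nonneg_right (mul_nonneg (hδ0 i).le (hρn _ _))
  have hform : ∀ i x, h i x = f x + ∑ k ∈ Finset.range i, δ k * ρ x (u k) := by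
    intro i x
    induction i with
    | zero => simp [hh, S]
    | succ i ih => rw [hsucc, ih, Finset.sum_range_succ, add_assoc]
  have hbdd : ∀ i, BddBelow (Set.range (h i)) := fun i => by
    obtain ⟨m, hm⟩ := hb
    refine ⟨m, ?_⟩
    rintro _ ⟨x, rfl⟩
    rw [hform]
    exact (hm ⟨x, rfl⟩).trans (le_add_of_nonneg_right
      (Finset.sum_nonneg fun k _ => mul_nonneg (hδ0 k).le (hρn _ _)))
  have hnear : ∀ i z, h i (u i) ≤ h i z + η i := fun i => by
    cases i with
    | zero => exact (hnext f x₀ 0 hb).2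
    | succ i => exact (hnext (h (i + 1)) (u i) (i + 1) (hbdd (i + 1))).2
  have hstart : h 0 (u 0) ≤ f x₀ := (hnext f x₀ 0 hb).1
  have hdec : ∀ i, h (i + 1) (u (i + 1)) ≤ h (i + 1) (u i) := fun i =>
    (hnext (h (i + 1)) (u i) (i + 1) (hbdd (i + 1))).1
  have hdec' : ∀ i, h (i + 1) (u (i + 1)) ≤ h i (u i) := fun i => by
    have := hdec i
    rwa [hsucc i (u i), hρ0, mul_zero, add_zero] at this
  have hle₀ : ∀ i, h i (u i) ≤ f x₀ := fun i => by
    induction i with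
    | zero => exact hstart
    | succ i ih => exact (hdec' i).trans ih
  have hdist : ∀ i, dist (u i) (u (i + 1)) ≤ (1 / 2) ^ i := fun i => by
    rw [dist_comm]
    refine (hd i _ _ ?_).le
    have h1 := hdec' i
    have h2 := hnear i (u (i + 1))
    rw [hsucc] at h1
    have h3 : δ i * ρ (u (i + 1)) (u i) ≤ δ i * (d i / 2) := by linarith [hη1 i]
    have h4 := le_of_mul_le_mul_left h3 (hδ0 i)
    linarith [hd0 i]
  have hcau : CauchySeq u := cauchySeq_of_le_geometric (1 / 2) 1 (by norm_num)
    (by simpa using hdist)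
  obtain ⟨y, hy⟩ := cauchySeq_tendsto_of_complete hcau
  have hsum : ∀ x, Summable fun i => δ i * ρ x (u i) := fun x =>
    hδs.of_nonneg_of_le (fun i => mul_nonneg (hδ0 i).le (hρn _ _))
      fun i => mul_le_of_le_one_right (hδ0 i).le (hρ1 _ _)
  set H : X → ℝ := fun x => f x + ∑' i, δ i * ρ x (u i) with hH
  have hHc : Continuous H := hf.add (continuous_tsum (fun i => (hρc (u i)).const_mul (δ i)) hδs
    fun i x => by
      rw [Real.norm_of_nonneg (mul_nonneg (hδ0 i).le (hρn _ _))]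
      exact mul_le_of_le_one_right (hδ0 i).le (hρ1 _ _))
  have hleH : ∀ i x, h i x ≤ H x := fun i x => by
    rw [hform, hH]
    have := (hsum x).sum_le_tsum (Finset.range i) fun k _ => mul_nonneg (hδ0 k).le (hρn x (u k))
    linarith
  have htail : ∀ i x, H x ≤ h i x + ∑' k, δ (k + i) := fun i x => by
    rw [hform, hH]
    have h1 := (hsum x).sum_add_tsum_nat_add i
    have h2 : ∑' k, δ (k + i) * ρ x (u (k + i)) ≤ ∑' k, δ (k + i) :=
      ((summable_nat_add_iff i).2 (hsum x)).tsum_le_tsum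
        (fun k => mul_le_of_le_one_right (hδ0 _).le (hρ1 _ _)) ((summable_nat_add_iff i).2 hδs)
    simp only
    linarith
  have hlim1 : Tendsto (fun i => H (u i)) atTop (𝓝 (H y)) := (hHc.tendsto y).comp hy
  have hlim2 : Tendsto (fun i => H (u i) - ∑' k, δ (k + i)) atTop (𝓝 (H y)) := by
    simpa using hlim1.sub (tendsto_sum_nat_add δ)
  have hHy : ∀ c, (∀ i, h i (u i) ≤ c + η i) → H y ≤ c := fun c hc => by
    refine le_of_tendsto_of_tendsto' hlim2
      (by simpa using (tendsto_const_nhds (x := c)).add hηlim) fun i => ?_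
    linarith [htail i (u i), hc i]
  refine ⟨u, y, hHy _ fun i => ?_, fun x => hHy _ fun i => ?_⟩
  · linarith [hle₀ i, hη0 i]
  · linarith [hnear i x, hleH i x]

end VariationalPrinciple

section Gauge

variable {E : Type*} [NormedAddCommGroup E] [NormedSpace ℝ E]

/-- A `C¹` function with values in `[0, 1]` and bounded derivative which is small only near `0`. -/
theorem IsReflexiveSpace.exists_bounded_gauge [CompleteSpace E] (hE : IsReflexiveSpace E) :
    ∃ β : E → ℝ, ContDiff ℝ 1 β ∧ β 0 = 0 ∧ (∀ x, 0 ≤ β x) ∧ (∀ x, β x ≤ 1) ∧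
      (∀ x, ‖fderiv ℝ β x‖ ≤ 1) ∧ ∀ ε : ℝ, 0 < ε → ∃ δ > 0, ∀ x, β x < δ → ‖x‖ < ε := by
  obtain ⟨θ, hθ, hθ0, hθn, hθd, hθg⟩ := hE.exists_smooth_gauge
  have hpos : ∀ x, 0 < 1 + θ x := fun x => by linarith [hθn x]
  refine ⟨fun x => 1 - (1 + θ x)⁻¹, ?_, by simp [hθ0], fun x => ?_, fun x => ?_, fun x => ?_,
    fun ε hε => ?_⟩
  · exact contDiff_const.sub ((contDiff_const.add hθ).inv fun x => (hpos x).ne')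
  · simp only
    rw [sub_nonneg]
    exact inv_le_one_of_one_le₀ (by linarith [hθn x])
  · simp only
    linarith [inv_pos.2 (hpos x)]
  · have h1 : HasFDerivAt θ (fderiv ℝ θ x) x := (hθ.differentiable one_ne_zero x).hasFDerivAt
    have h2 := ((hasDerivAt_inv (hpos x).ne').comp_hasFDerivAt x (h1.const_add 1)).const_sub 1
    have h3 : fderiv ℝ (fun x => 1 - (1 + θ x)⁻¹) x = -(-((1 + θ x) ^ 2)⁻¹ • fderiv ℝ θ x) :=
      h2.fderiv
    rw [h3, norm_neg, norm_smul, norm_neg, norm_inv, Real.norm_of_nonneg (by positivity)]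
    refine mul_le_one₀ (inv_le_one_of_one_le₀ ?_) (norm_nonneg _) (hθd x)
    nlinarith [hθn x]
  · set s := min 1 (ε / 8) with hs
    have hs0 : 0 < s := lt_min one_pos (by positivity)
    have hs1 : s ≤ 1 := min_le_left _ _
    have hs2 : s ≤ ε / 8 := min_le_right _ _
    set σ := s * (ε / 2) with hσ
    have hσ0 : 0 < σ := by positivity
    refine ⟨1 - (1 + σ)⁻¹, ?_, fun x hx => ?_⟩
    · rw [gt_iff_lt, sub_pos]
      exact inv_lt_one_of_one_lt₀ (by linarith)
    · have h1 : (1 + σ)⁻¹ < (1 + θ x)⁻¹ := by linarith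
      rw [inv_lt_inv₀ (by linarith) (hpos x)] at h1
      have h2 := hθg x s hs0.le hs1
      have h3 : s * ‖x‖ < s * ε := by nlinarith
      exact lt_of_mul_lt_mul_left h3 hs0.le

theorem nonneg_of_hasDerivAt_of_le {φ : ℝ → ℝ} {d a : ℝ} (hd : HasDerivAt φ d 0) (ha : 0 < a)
    (h : ∀ s, 0 < s → s < a → φ 0 ≤ φ s) : 0 ≤ d := by
  have h1 : Tendsto (slope φ 0) (𝓝[>] 0) (𝓝 d) :=
    (hasDerivAt_iff_tendsto_slope.1 hd).mono_left (nhdsWithin_mono _ fun x hx => hx.ne')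
  refine ge_of_tendsto h1 ?_
  filter_upwards [Ioo_mem_nhdsGT ha] with s hs
  rw [slope_def_field, sub_zero]
  exact div_nonneg (sub_nonneg.2 (h s hs.1 hs.2)) hs.1.le

/-- A convergent series of translates of a bounded gauge is `C¹` with small derivative. -/
theorem contDiff_tsum_gauge {β : E → ℝ} (hβ : ContDiff ℝ 1 β) (h0 : ∀ x, 0 ≤ β x)
    (h1 : ∀ x, β x ≤ 1) (hd : ∀ x, ‖fderiv ℝ β x‖ ≤ 1) (u : ℕ → E) {ε : ℝ} (hε : 0 < ε) :
    ContDiff ℝ 1 (fun z => ∑' i, ε * (1 / 2) ^ i * (β (z - u i) / 2)) ∧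
      ∀ z, ‖fderiv ℝ (fun z => ∑' i, ε * (1 / 2) ^ i * (β (z - u i) / 2)) z‖ ≤ ε := by
  have hcd : ∀ i, ContDiff ℝ 1 fun z => ε * (1 / 2) ^ i * (β (z - u i) / 2) := fun i =>
    contDiff_const.mul ((hβ.comp (contDiff_id.sub contDiff_const)).div_const 2)
  have hfd : ∀ i z, ‖fderiv ℝ (fun z => ε * (1 / 2) ^ i * (β (z - u i) / 2)) z‖ ≤
      ε * (1 / 2) ^ i / 2 := fun i z => by
    have e : (fun z => ε * (1 / 2) ^ i * (β (z - u i) / 2)) =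
        fun z => (ε * (1 / 2) ^ i / 2) * β (z - u i) := by ext z; ring
    have hdβ : DifferentiableAt ℝ (fun z => β (z - u i)) z :=
      ((hβ.comp (contDiff_id.sub contDiff_const)).differentiable one_ne_zero) z
    rw [e, fderiv_const_mul hdβ, norm_smul, Real.norm_of_nonneg (by positivity),
      fderiv_comp_sub]
    exact mul_le_of_le_one_right (by positivity) (hd _)
  have hs : Summable fun i : ℕ => ε * (1 / 2 : ℝ) ^ i := summable_geometric_two.mul_left ε
  have hs2 : Summable fun i : ℕ => ε * (1 / 2 : ℝ) ^ i / 2 := hs.div_const 2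
  have hval : ∀ i z, ‖ε * (1 / 2) ^ i * (β (z - u i) / 2)‖ ≤ ε * (1 / 2) ^ i := fun i z => by
    have := h0 (z - u i)
    rw [Real.norm_of_nonneg (by positivity)]
    exact mul_le_of_le_one_right (by positivity) (by linarith [h1 (z - u i)])
  have hle : ∀ i : ℕ, ε * (1 / 2 : ℝ) ^ i / 2 ≤ ε * (1 / 2) ^ i := fun i => by
    have : 0 < ε * (1 / 2 : ℝ) ^ i := by positivity
    linarith
  refine ⟨contDiff_tsum (v := fun _ i => ε * (1 / 2 : ℝ) ^ i) hcd (fun _ _ => hs) ?_, fun z => ?_⟩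
  · intro k i z hk
    have hk' : k = 0 ∨ k = 1 := by
      have : k ≤ 1 := by exact_mod_cast hk
      omega
    rcases hk' with rfl | rfl
    · rw [norm_iteratedFDeriv_zero]
      exact hval i z
    · rw [norm_iteratedFDeriv_one]
      exact (hfd i z).trans (hle i)
  · rw [fderiv_tsum hs2 (fun i z => (hcd i).differentiable one_ne_zero z) hfd (x₀ := z)
      (hs.of_norm_bounded fun i => hval i z)]
    refine tsum_of_norm_bounded (a := ε) ?_ fun i => hfd i z
    have := (hasSum_geometric_two.mul_left ε).div_const 2
    simpa using this

end Gauge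

section MeanValue

variable {E : Type*} [NormedAddCommGroup E] [NormedSpace ℝ E]

/-- The truncated convex cone over `{1} × W`. -/
def truncatedCone (T : ℝ) (W : Set E) : Set (ℝ × E) :=
  {c | 0 ≤ c.1 ∧ c.1 ≤ T ∧ ∃ w ∈ W, c.2 = c.1 • w}

theorem isClosed_truncatedCone {W : Set E} (hW : IsClosed W) (hne : W.Nonempty) {R : ℝ}
    (hR : ∀ w ∈ W, ‖w‖ ≤ R) (T : ℝ) : IsClosed (truncatedCone T W) := by
  refine isClosed_of_closure_subset fun c hc => ?_
  obtain ⟨p, hp, hpc⟩ := mem_closure_iff_seq_limit.1 hc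
  choose h0 hT w hw hpw using hp
  have hl1 : Tendsto (fun k => (p k).1) atTop (𝓝 c.1) := (continuous_fst.tendsto c).comp hpc
  have hl2 : Tendsto (fun k => (p k).2) atTop (𝓝 c.2) := (continuous_snd.tendsto c).comp hpc
  have hc0 : 0 ≤ c.1 := ge_of_tendsto' hl1 h0
  refine ⟨hc0, le_of_tendsto' hl1 hT, ?_⟩
  rcases hc0.eq_or_lt with h | h
  · obtain ⟨w₀, hw₀⟩ := hne
    refine ⟨w₀, hw₀, ?_⟩
    rw [← h, zero_smul]
    refine tendsto_nhds_unique hl2 (squeeze_zero_norm (a := fun k => (p k).1 * R) (fun k => ?_) ?_)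
    · rw [hpw, norm_smul, Real.norm_of_nonneg (h0 k)]
      exact mul_le_mul_of_nonneg_left (hR _ (hw k)) (h0 k)
    · rw [← h] at hl1
      simpa using hl1.mul_const R
  · have hl3 : Tendsto (fun k => (p k).1⁻¹ • (p k).2) atTop (𝓝 (c.1⁻¹ • c.2)) :=
      (hl1.inv₀ h.ne').smul hl2
    refine ⟨c.1⁻¹ • c.2, hW.mem_of_tendsto hl3 ?_, by rw [smul_inv_smul₀ h.ne']⟩
    filter_upwards [hl1.eventually (lt_mem_nhds h)] with k hk
    rw [hpw, inv_smul_smul₀ (ne_of_gt hk)]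
    exact hw k

theorem add_smul_mem_truncatedCone {W : Set E} (hW : Convex ℝ W) {T : ℝ} {c : ℝ × E}
    (hc : c ∈ truncatedCone T W) {w : E} (hw : w ∈ W) {s : ℝ} (hs : 0 < s) (hsT : c.1 + s ≤ T) :
    (c.1 + s, c.2 + s • w) ∈ truncatedCone T W := by
  obtain ⟨h0, -, w', hw', hcw⟩ := hc
  have hpos : 0 < c.1 + s := by linarith
  refine ⟨hpos.le, hsT, (c.1 / (c.1 + s)) • w' + (s / (c.1 + s)) • w,
    hW hw' hw (by positivity) (by positivity) (by field_simp), ?_⟩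
  simp only [hcw, smul_add, smul_smul]
  congr 2 <;> field_simp

theorem norm_snd_le_of_mem_truncatedCone {W : Set E} {R : ℝ} (hR : ∀ w ∈ W, ‖w‖ ≤ R) {T : ℝ}
    {c : ℝ × E} (hc : c ∈ truncatedCone T W) : ‖c.2‖ ≤ T * R := by
  obtain ⟨h0, hT, w, hw, hcw⟩ := hc
  rw [hcw, norm_smul, Real.norm_of_nonneg h0]
  exact mul_le_mul hT (hR w hw) (norm_nonneg _) (h0.trans hT)

/-- A multidirectional mean value inequality: if a Lipschitz function grows at rate `r'` from `x₀`
to `x₀ + T W`, then near `x₀` it is touched from below by a `C¹` function whose derivative is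
almost at least `r < r'` in all directions of `W`. -/
theorem IsReflexiveSpace.exists_multidirectional_mean_value [CompleteSpace E]
    (hE : IsReflexiveSpace E) {ψ : E → ℝ} {L : NNReal} (hψ : LipschitzWith L ψ) {W : Set E}
    (hWc : IsClosed W) (hWconv : Convex ℝ W) (hWne : W.Nonempty) {R : ℝ}
    (hR : ∀ w ∈ W, ‖w‖ ≤ R) {x₀ : E} {r r' T : ℝ} (hT : 0 < T) (hr : r < r')
    (hgrow : ∀ w ∈ W, T * r' ≤ ψ (x₀ + T • w) - ψ x₀) {ε : ℝ} (hε : 0 < ε) :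
    ∃ (g : E → ℝ) (z : E), ContDiff ℝ 1 g ∧ ‖z - x₀‖ ≤ T * (R + L * R + 1 + |r|) ∧
      (∀ y, ψ z - g z ≤ ψ y - g y) ∧ ∀ w ∈ W, r - ε ≤ fderiv ℝ g z w := by
  obtain ⟨θ, hθ, hθ0, hθn, hθd, hθg⟩ := hE.exists_smooth_gauge
  obtain ⟨β, hβ, hβ0, hβn, hβ1, hβd, hβg⟩ := hE.exists_bounded_gauge
  obtain ⟨w₀, hw₀⟩ := hWne
  have hR0 : 0 ≤ R := (norm_nonneg _).trans (hR w₀ hw₀)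
  have hL0 : (0 : ℝ) ≤ L := L.2
  have hlip : ∀ x y, ψ x ≤ ψ y + L * ‖x - y‖ := fun x y => by
    have h := hψ.dist_le_mul x y
    rw [Real.dist_eq, dist_eq_norm] at h
    linarith [le_abs_self (ψ x - ψ y)]
  set δ := min (T * (r' - r) / 2) T with hδ
  have hδ0 : 0 < δ := lt_min (by have := sub_pos.2 hr; positivity) hT
  have hδT : δ ≤ T := min_le_right _ _
  have hδr : δ < T * (r' - r) := by
    have h1 : δ ≤ T * (r' - r) / 2 := min_le_left _ _
    have h2 : 0 < T * (r' - r) := mul_pos hT (sub_pos.2 hr)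
    linarith
  obtain ⟨K, hK0, hK⟩ : ∃ K : ℝ, 0 < K ∧ ∀ y, 2 * (L + 1) * ‖y‖ - δ ≤ K * θ y := by
    set s := min 1 (δ / (4 * (L + 1))) with hs
    have hs0 : 0 < s := lt_min one_pos (by positivity)
    have hs1 : s ≤ 1 := min_le_left _ _
    have hs2 : s ≤ δ / (4 * (L + 1)) := min_le_right _ _
    refine ⟨2 * (L + 1) / s, by positivity, fun y => ?_⟩
    have h1 := mul_le_mul_of_nonneg_left (hθg y s hs0.le hs1)
      (show 0 ≤ 2 * ((L : ℝ) + 1) / s by positivity)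
    have e : 2 * ((L : ℝ) + 1) / s * (s * ‖y‖ - 2 * s ^ 2) =
        2 * (L + 1) * ‖y‖ - s * (4 * (L + 1)) := by field_simp; ring
    rw [le_div_iff₀ (by positivity)] at hs2
    rw [e] at h1
    linarith
  set C := truncatedCone T W with hC
  have hCc : IsClosed C := isClosed_truncatedCone hWc ⟨w₀, hw₀⟩ hR T
  have : CompleteSpace C := hCc.completeSpace_coe
  set H : E × C → ℝ := fun p => ψ p.1 + K * θ (x₀ + p.2.1.2 - p.1) - p.2.1.1 * r with hH
  have hHc : Continuous H := by
    have h1 := hψ.continuous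
    have h2 := hθ.continuous
    fun_prop
  have htr : ∀ c : C, c.1.1 * r ≤ T * |r| := fun c =>
    (mul_le_mul_of_nonneg_left (le_abs_self r) c.2.1).trans
      (mul_le_mul_of_nonneg_right c.2.2.1 (abs_nonneg r))
  have hlow : ∀ p : E × C, ψ (x₀ + p.2.1.2) + (L + 2) * ‖x₀ + p.2.1.2 - p.1‖ - δ - p.2.1.1 * r
      ≤ H p := fun p => by
    have h1 := hlip (x₀ + p.2.1.2) p.1
    have h2 := hK (x₀ + p.2.1.2 - p.1)
    simp only [hH]
    linarith
  have hHb : BddBelow (Set.range H) := by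
    refine ⟨ψ x₀ - L * (T * R) - δ - T * |r|, ?_⟩
    rintro _ ⟨p, rfl⟩
    have h1 := hlow p
    have h2 := hlip x₀ (x₀ + p.2.1.2)
    have h3 := htr p.2
    have h4 : (0 : ℝ) ≤ (L + 2) * ‖x₀ + p.2.1.2 - p.1‖ := by positivity
    have h5 := mul_le_mul_of_nonneg_left (norm_snd_le_of_mem_truncatedCone hR p.2.2) hL0
    rw [sub_add_cancel_left, norm_neg] at h2
    linarith
  set ρ : E × C → E × C → ℝ := fun p p' => β (p.1 - p'.1) / 2 + min 1 (dist p.2 p'.2) / 2 with hρ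
  have hβc := hβ.continuous
  set ε' := ε / (1 + 2 * R) with hε'
  have hε'0 : 0 < ε' := by positivity
  have hzC : ((0, 0) : ℝ × E) ∈ C := ⟨le_rfl, hT.le, w₀, hw₀, by simp⟩
  obtain ⟨u, ⟨z, c⟩, hstart, hmin⟩ := exists_minimizer_of_gauge hHc hHb (ρ := ρ)
    (fun p' => by simp only [hρ]; fun_prop) (fun p => by simp [hρ, hβ0])
    (fun p p' => add_nonneg (div_nonneg (hβn _) two_pos.le)
      (div_nonneg (le_min zero_le_one dist_nonneg) two_pos.le))
    (fun p p' => by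
      have h1 := hβ1 (p.1 - p'.1)
      have h2 := min_le_left 1 (dist p.2 p'.2)
      simp only [hρ]
      linarith)
    (fun η hη => by
      obtain ⟨d, hd0, hd⟩ := hβg η hη
      refine ⟨min (d / 2) (min (1 / 2) (η / 2)), by positivity, fun p p' hpp => ?_⟩
      simp only [hρ, lt_min_iff] at hpp
      have h1 := hβn (p.1 - p'.1)
      have h2 : 0 ≤ min 1 (dist p.2 p'.2) := le_min zero_le_one dist_nonneg
      have h3 : ‖p.1 - p'.1‖ < η := hd _ (by linarith [hpp.1])
      have h4 : min 1 (dist p.2 p'.2) < min 1 η := lt_min (by linarith [hpp.2.1])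
        (by linarith [hpp.2.2])
      have h5 : dist p.2 p'.2 < η := by
        rcases min_lt_iff.1 (h4.trans_le (min_le_right _ _)) with h | h
        · have : min (1 : ℝ) η = 1 := min_eq_left h.le
          rw [this] at h4
          rcases min_lt_iff.1 h4 with h' | h'
          · exact absurd h' (lt_irrefl _)
          · exact h'.trans h
        · exact h
      rw [Prod.dist_eq, dist_eq_norm]
      exact max_lt h3 h5)
    (x₀, ⟨(0, 0), hzC⟩) hε'0
  set B : E → ℝ := fun z => ∑' i, ε' * (1 / 2) ^ i * (β (z - (u i).1) / 2) with hB
  obtain ⟨hBc, hBd⟩ := contDiff_tsum_gauge hβ hβn hβ1 hβd (fun i => (u i).1) hε'0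
  set A : C → ℝ := fun c => ∑' i, ε' * (1 / 2) ^ i * (min 1 (dist c (u i).2) / 2) with hA
  have hs : Summable fun i : ℕ => ε' * (1 / 2 : ℝ) ^ i := summable_geometric_two.mul_left ε'
  have hBs : ∀ z, Summable fun i => ε' * (1 / 2) ^ i * (β (z - (u i).1) / 2) := fun z =>
    hs.of_nonneg_of_le (fun i => mul_nonneg (by positivity) (div_nonneg (hβn _) two_pos.le))
      fun i => mul_le_of_le_one_right (by positivity) (by linarith [hβ1 (z - (u i).1)])
  have hm0 : ∀ (c : C) i, 0 ≤ min 1 (dist c (u i).2) := fun c i => le_min zero_le_one dist_nonneg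
  have hAs : ∀ c, Summable fun i => ε' * (1 / 2) ^ i * (min 1 (dist c (u i).2) / 2) := fun c =>
    hs.of_nonneg_of_le (fun i => mul_nonneg (by positivity) (div_nonneg (hm0 c i) two_pos.le))
      fun i => mul_le_of_le_one_right (by positivity)
        (by linarith [min_le_left 1 (dist c (u i).2)])
  have hsplit : ∀ z c, ∑' i, ε' * (1 / 2) ^ i * ρ (z, c) (u i) = B z + A c := fun z c => by
    rw [hB, hA, ← (hBs z).tsum_add (hAs c)]
    simp only [hρ, mul_add]
  have hAlip : ∀ c c', A c ≤ A c' + ε' * dist c c' := fun c c' => by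
    have h1 : HasSum (fun i : ℕ => ε' * (1 / 2 : ℝ) ^ i * (dist c c' / 2)) (ε' * dist c c') := by
      rw [show ε' * dist c c' = ε' * 2 * (dist c c' / 2) by ring]
      exact (hasSum_geometric_two.mul_left ε').mul_right (dist c c' / 2)
    rw [← h1.tsum_eq, ← (hAs c').tsum_add h1.summable]
    refine (hAs c).tsum_le_tsum (fun i => ?_) ((hAs c').add h1.summable)
    rw [← mul_add, ← add_div]
    gcongr
    rw [← min_add_add_right]
    refine le_min ((min_le_left _ _).trans (le_add_of_nonneg_right dist_nonneg))
      ((min_le_right _ _).trans ?_)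
    rw [add_comm]
    exact dist_triangle _ _ _
  simp only [hsplit] at hstart hmin
  have hBA : 0 ≤ B z + A c := add_nonneg
    (tsum_nonneg fun i => mul_nonneg (by positivity) (div_nonneg (hβn _) two_pos.le))
    (tsum_nonneg fun i => mul_nonneg (by positivity) (div_nonneg (hm0 c i) two_pos.le))
  have hHle : H (z, c) ≤ ψ x₀ := by
    have : H (x₀, ⟨(0, 0), hzC⟩) = ψ x₀ := by simp [hH, hθ0]
    linarith
  have hcz := hlow (z, c)
  simp only at hcz
  have hcT : c.1.1 < T := by
    refine lt_of_le_of_ne c.2.2.1 fun h => ?_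
    obtain ⟨-, -, w, hw, hcw⟩ := c.2
    have h1 := hgrow w hw
    have h2 : (0 : ℝ) ≤ (L + 2) * ‖x₀ + c.1.2 - z‖ := by positivity
    rw [hcw, h] at hcz
    rw [hcw, h] at h2
    linarith
  have hc2 := norm_snd_le_of_mem_truncatedCone hR c.2
  set y := x₀ + c.1.2 - z with hy
  refine ⟨fun x => -(K * θ (x₀ + c.1.2 - x) + B x), z, ?_, ?_, fun x => ?_, fun w hw => ?_⟩
  · exact ((contDiff_const.mul (hθ.comp (contDiff_const.sub contDiff_id))).add hBc).neg
  · have h2 := hlip x₀ (x₀ + c.1.2)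
    have h3 := htr c
    rw [sub_add_cancel_left, norm_neg] at h2
    have h4 := mul_le_mul_of_nonneg_left hc2 hL0
    have h6 : ‖y‖ ≤ (L + 2) * ‖y‖ := le_mul_of_one_le_left (norm_nonneg _) (by linarith)
    have e : z - x₀ = c.1.2 - y := by rw [hy]; abel
    have h7 := norm_sub_le c.1.2 y
    rw [e]
    linarith
  · have := hmin (x, c)
    simp only [hH] at this
    linarith
  · have hθy : HasFDerivAt θ (fderiv ℝ θ y) y := (hθ.differentiable one_ne_zero y).hasFDerivAt
    have hBz : HasFDerivAt B (fderiv ℝ B z) z := (hBc.differentiable one_ne_zero z).hasFDerivAt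
    have h1 : HasFDerivAt (fun x => -(K * θ (x₀ + c.1.2 - x) + B x))
        (-(K • (fderiv ℝ θ y).comp (-ContinuousLinearMap.id ℝ E) + fderiv ℝ B z)) z :=
      (((hθy.comp z ((hasFDerivAt_id z).const_sub (x₀ + c.1.2))).const_mul K).add hBz).neg
    rw [h1.fderiv]
    have e : (-(K • (fderiv ℝ θ y).comp (-ContinuousLinearMap.id ℝ E) + fderiv ℝ B z)) w =
        K * fderiv ℝ θ y w - fderiv ℝ B z w := by
      simp
      ring
    rw [e]
    have h2 : fderiv ℝ B z w ≤ ε' * R :=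
      ((le_abs_self _).trans ((fderiv ℝ B z).le_opNorm w)).trans
        (mul_le_mul (hBd z) (hR w hw) (norm_nonneg _) hε'0.le)
    have h3 : 0 ≤ K * fderiv ℝ θ y w - (r - ε' * (1 + R)) := by
      have hline : HasDerivAt (fun s : ℝ => y + s • w) w 0 := by
        simpa using ((hasDerivAt_id (0 : ℝ)).smul_const w).const_add y
      have hd1 : HasDerivAt (fun s : ℝ => θ (y + s • w)) (fderiv ℝ θ y w) 0 := by
        refine HasFDerivAt.comp_hasDerivAt (0 : ℝ) ?_ hline
        simpa using hθy
      have hd2 := (hd1.const_mul K).sub ((hasDerivAt_id (0 : ℝ)).mul_const (r - ε' * (1 + R)))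
      rw [one_mul] at hd2
      refine nonneg_of_hasDerivAt_of_le hd2 (sub_pos.2 hcT) fun s hs0 hsT => ?_
      have hmem := add_smul_mem_truncatedCone hWconv c.2 hw hs0 (by linarith)
      have h4 := hmin (z, ⟨_, hmem⟩)
      have h5 := hAlip ⟨_, hmem⟩ c
      have h6 : dist (⟨_, hmem⟩ : C) c ≤ s * (1 + R) := by
        rw [Subtype.dist_eq, Prod.dist_eq, dist_eq_norm, dist_eq_norm]
        simp only [add_sub_cancel_left]
        rw [norm_smul, Real.norm_of_nonneg hs0.le]
        refine max_le (le_mul_of_one_le_right hs0.le (by linarith)) ?_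
        exact mul_le_mul_of_nonneg_left (by linarith [hR w hw]) hs0.le
      have h7 := mul_le_mul_of_nonneg_left h6 hε'0.le
      have e2 : x₀ + (c.1.2 + s • w) - z = y + s • w := by rw [hy]; abel
      simp only [hH, e2] at h4
      simp
      linarith
    have e3 : ε' * (1 + 2 * R) = ε := by rw [hε']; field_simp
    linarith

end MeanValue

section Charts

variable {E : Type*} [NormedAddCommGroup E] [NormedSpace ℝ E]
  {M : Type*} [TopologicalSpace M] [ChartedSpace E M]
  {φ φ' : OpenPartialHomeomorph M E} {p : M}

theorem IsChartAround.contMDiffAt (h : IsChartAround φ p) :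
    ContMDiffAt 𝓘(ℝ, E) 𝓘(ℝ, E) 1 φ p :=
  contMDiffAt_of_mem_maximalAtlas h.1 h.2

theorem IsChartAround.mdifferentiableAt (h : IsChartAround φ p) :
    MDifferentiableAt 𝓘(ℝ, E) 𝓘(ℝ, E) φ p :=
  h.contMDiffAt.mdifferentiableAt one_ne_zero

theorem IsChartAround.isInvertible_mvfderiv (h : IsChartAround φ p) :
    (mvfderiv 𝓘(ℝ, E) φ p).IsInvertible := by
  have hd : φ.MDifferentiable 𝓘(ℝ, E) 𝓘(ℝ, E) :=
    ⟨(contMDiffOn_of_mem_maximalAtlas h.1).mdifferentiableOn one_ne_zero,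
      (contMDiffOn_symm_of_mem_maximalAtlas h.1).mdifferentiableOn one_ne_zero⟩
  exact ⟨(hd.mfderiv h.2).trans (NormedSpace.fromTangentSpace (φ p)), rfl⟩

theorem mvfderiv_eq_of_eventuallyEq {F : Type*} [NormedAddCommGroup F] [NormedSpace ℝ F]
    {g : M → F} {h : E → F} (hφ : IsChartAround φ p) (hh : DifferentiableAt ℝ h (φ p))
    (hg : g =ᶠ[𝓝 p] h ∘ φ) :
    mvfderiv 𝓘(ℝ, E) g p = (fderiv ℝ h (φ p)).comp (mvfderiv 𝓘(ℝ, E) φ p) := by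
  have h1 : HasMFDerivAt 𝓘(ℝ, E) 𝓘(ℝ, F) (h ∘ φ) p
      ((fderiv ℝ h (φ p)).comp (mfderiv 𝓘(ℝ, E) 𝓘(ℝ, E) φ p)) :=
    hh.hasFDerivAt.hasMFDerivAt.comp p hφ.mdifferentiableAt.hasMFDerivAt
  have h2 := (h1.congr_of_eventuallyEq hg).mfderiv
  ext v
  have h3 := congrArg (fun A => A v) h2
  exact h3

theorem IsChartAround.contDiffAt_transition (hφ : IsChartAround φ p) (hφ' : IsChartAround φ' p) :
    ContDiffAt ℝ 1 (φ ∘ φ'.symm) (φ' p) := by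
  rw [← contMDiffAt_iff_contDiffAt]
  have h1 : ContMDiffAt 𝓘(ℝ, E) 𝓘(ℝ, E) 1 φ'.symm (φ' p) :=
    contMDiffAt_symm_of_mem_maximalAtlas hφ'.1 (φ'.map_source hφ'.2)
  refine ContMDiffAt.comp (φ' p) ?_ h1
  rw [φ'.left_inv hφ'.2]
  exact hφ.contMDiffAt

theorem IsChartAround.eventually (h : IsChartAround φ p) : ∀ᶠ p' in 𝓝 p, IsChartAround φ p' := by
  filter_upwards [φ.open_source.mem_nhds h.2] with p' hp'
  exact ⟨h.1, hp'⟩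

theorem mvfderiv_inverse_eq_transition (hφ : IsChartAround φ p) (hφ' : IsChartAround φ' p) (w : E) :
    mvfderiv 𝓘(ℝ, E) φ p ((mvfderiv 𝓘(ℝ, E) φ' p).inverse w) =
      fderiv ℝ (φ ∘ φ'.symm) (φ' p) w := by
  have h1 : mvfderiv 𝓘(ℝ, E) φ p =
      (fderiv ℝ (φ ∘ φ'.symm) (φ' p)).comp (mvfderiv 𝓘(ℝ, E) φ' p) := by
    refine mvfderiv_eq_of_eventuallyEq hφ'
      ((hφ.contDiffAt_transition hφ').differentiableAt one_ne_zero) ?_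
    filter_upwards [φ'.open_source.mem_nhds hφ'.2] with p' hp'
    simp [φ'.left_inv hp']
  obtain ⟨A, hA⟩ := hφ'.isInvertible_mvfderiv
  rw [h1, ← hA]
  simp

theorem IsLocallyLipschitzOnManifold.lipschitzOnWith_chart {ℓ : M → ℝ}
    (hℓ : IsLocallyLipschitzOnManifold (E := E) ℓ) (hφ : IsChartAround φ p) :
    ∃ K : NNReal, ∃ U ∈ 𝓝 (φ p), LipschitzOnWith K (ℓ ∘ φ.symm) U := by
  obtain ⟨φ', hφ', K', U', hU', hL'⟩ := hℓ p
  have hC := hφ'.contDiffAt_transition hφ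
  obtain ⟨K, t, ht, hLt⟩ := hC.exists_lipschitzOnWith
  have hcont : ContinuousAt (φ' ∘ φ.symm) (φ p) := hC.continuousAt
  have hval : (φ' ∘ φ.symm) (φ p) = φ' p := by simp [φ.left_inv hφ.2]
  have hpre : (φ' ∘ φ.symm) ⁻¹' U' ∈ 𝓝 (φ p) := hcont.preimage_mem_nhds (by rwa [hval])
  have hsrc : φ.symm ⁻¹' φ'.source ∈ 𝓝 (φ p) := by
    refine (φ.continuousAt_symm (φ.map_source hφ.2)).preimage_mem_nhds ?_
    rw [φ.left_inv hφ.2]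
    exact φ'.open_source.mem_nhds hφ'.2
  refine ⟨K' * K, t ∩ ((φ' ∘ φ.symm) ⁻¹' U' ∩ φ.symm ⁻¹' φ'.source),
    inter_mem ht (inter_mem hpre hsrc), ?_⟩
  have hcomp := hL'.comp (hLt.mono (Set.inter_subset_left
    (t := (φ' ∘ φ.symm) ⁻¹' U' ∩ φ.symm ⁻¹' φ'.source))) fun y hy => hy.2.1
  intro x hx y hy
  have e : ∀ z ∈ t ∩ ((φ' ∘ φ.symm) ⁻¹' U' ∩ φ.symm ⁻¹' φ'.source),
      (ℓ ∘ φ.symm) z = ((ℓ ∘ φ'.symm) ∘ φ' ∘ φ.symm) z := fun z hz => by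
    simp [φ'.left_inv hz.2.2]
  rw [e x hx, e y hy]
  exact hcomp hx hy

/-- A `C¹` function on the model space that touches `ψ` from below in a chart gives an element of
the Fréchet subdifferential. -/
theorem IsReflexiveSpace.comp_mvfderiv_mem_frechetSubdifferential [CompleteSpace E] [T3Space M]
    (hE : IsReflexiveSpace E) {ψ : M → ℝ} (hφ : IsChartAround φ p) {h : E → ℝ}
    (hh : ContDiff ℝ 1 h)
    (hmin : ∀ᶠ y in 𝓝 (φ p), ψ p - h (φ p) ≤ ψ (φ.symm y) - h y) :
    (fderiv ℝ h (φ p)).comp (mvfderiv 𝓘(ℝ, E) φ p) ∈ frechetSubdifferential ψ p := by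
  classical
  obtain ⟨β, hβ, hβ0, -, -, -, hβg⟩ := hE.exists_bounded_gauge
  obtain ⟨N, hN, hNc, hNs⟩ := exists_mem_nhds_isClosed_subset (φ.open_source.mem_nhds hφ.2)
  have hpre : φ.symm ⁻¹' N ∈ 𝓝 (φ p) := by
    refine (φ.continuousAt_symm (φ.map_source hφ.2)).preimage_mem_nhds ?_
    rwa [φ.left_inv hφ.2]
  obtain ⟨ε, hε, hball⟩ := Metric.mem_nhds_iff.1 hpre
  obtain ⟨δ, hδ, hδε⟩ := hβg ε hε
  set χ : E → ℝ := fun y => Real.smoothTransition (2 - 3 * (β (y - φ p) / δ)) with hχ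
  have hχc : ContDiff ℝ 1 χ := by
    refine (Real.smoothTransition.contDiff (n := 1)).comp ?_
    exact contDiff_const.sub (contDiff_const.mul
      ((hβ.comp (contDiff_id.sub contDiff_const)).div_const δ))
  have hχ0 : ∀ y, χ y ≠ 0 → ‖y - φ p‖ < ε := fun y hy => by
    refine hδε _ (not_le.1 fun hle => hy (Real.smoothTransition.zero_of_nonpos ?_))
    have := (one_le_div hδ).2 hle
    linarith
  have hχ1 : ∀ᶠ y in 𝓝 (φ p), χ y = 1 := by
    have hc : ContinuousAt (fun y => β (y - φ p) / δ) (φ p) := by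
      have := hβ.continuous
      fun_prop
    have hlt : β (φ p - φ p) / δ < 1 / 3 := by simp [hβ0]
    filter_upwards [hc.eventually (gt_mem_nhds hlt)] with y hy
    exact Real.smoothTransition.one_of_one_le (by linarith)
  set g : M → ℝ := fun x => if x ∈ φ.source then χ (φ x) * h (φ x) else 0 with hg
  have hgsupp : ∀ x, x ∉ N → g x = 0 := fun x hx => by
    by_cases hxs : x ∈ φ.source
    · simp only [hg, if_pos hxs]
      by_contra hne
      have h1 : φ x ∈ Metric.ball (φ p) ε := by
        rw [mem_ball_iff_norm]
        exact hχ0 _ (left_ne_zero_of_mul hne)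
      have h2 : φ.symm (φ x) ∈ N := hball h1
      rw [φ.left_inv hxs] at h2
      exact hx h2
    · simp [hg, hxs]
  have hgC : ContMDiff 𝓘(ℝ, E) 𝓘(ℝ, ℝ) 1 g := by
    intro x
    by_cases hxs : x ∈ φ.source
    · have h1 : ContMDiffAt 𝓘(ℝ, E) 𝓘(ℝ, ℝ) 1 ((fun y => χ y * h y) ∘ φ) x :=
        (hχc.mul hh).contMDiff.contMDiffAt.comp x (IsChartAround.contMDiffAt ⟨hφ.1, hxs⟩)
      refine h1.congr_of_eventuallyEq ?_
      filter_upwards [φ.open_source.mem_nhds hxs] with y hy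
      simp [hg, hy]
    · have hxN : x ∉ N := fun hx => hxs (hNs hx)
      have h1 : ContMDiffAt 𝓘(ℝ, E) 𝓘(ℝ, ℝ) 1 (fun _ : M => (0 : ℝ)) x := contMDiffAt_const
      refine h1.congr_of_eventuallyEq ?_
      filter_upwards [hNc.isOpen_compl.mem_nhds hxN] with y hy
      exact hgsupp y hy
  have hcφ : ContinuousAt φ p := φ.continuousAt hφ.2
  have hgp : g =ᶠ[𝓝 p] h ∘ φ := by
    filter_upwards [φ.open_source.mem_nhds hφ.2, hcφ.eventually hχ1] with x hx hx1
    simp [hg, hx, hx1]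
  refine ⟨g, hgC, ?_, mvfderiv_eq_of_eventuallyEq hφ (hh.differentiable one_ne_zero _) hgp⟩
  filter_upwards [hgp, φ.open_source.mem_nhds hφ.2, hcφ.eventually hmin] with x hx hxs hxm
  rw [φ.left_inv hxs] at hxm
  rw [hx, hgp.eq_of_nhds]
  exact hxm

theorem norm_fderiv_le_of_touching {ψ h : E → ℝ} {L : NNReal} (hψ : LipschitzWith L ψ)
    (hh : ContDiff ℝ 1 h) {z : E} (hmin : ∀ y, ψ z - h z ≤ ψ y - h y) : ‖fderiv ℝ h z‖ ≤ L := by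
  have key : ∀ v, fderiv ℝ h z v ≤ L * ‖v‖ := fun v => by
    have hz : HasFDerivAt h (fderiv ℝ h z) z := (hh.differentiable one_ne_zero z).hasFDerivAt
    have hline : HasDerivAt (fun s : ℝ => z + s • v) v 0 := by
      simpa using ((hasDerivAt_id (0 : ℝ)).smul_const v).const_add z
    have hd1 : HasDerivAt (fun s : ℝ => h (z + s • v)) (fderiv ℝ h z v) 0 := by
      refine HasFDerivAt.comp_hasDerivAt (0 : ℝ) ?_ hline
      simpa using hz
    have hd2 := ((hasDerivAt_id (0 : ℝ)).mul_const (L * ‖v‖)).sub hd1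
    have := nonneg_of_hasDerivAt_of_le hd2 one_pos fun s hs0 _ => by
      have h1 := hmin (z + s • v)
      have h2 := (le_abs_self _).trans (hψ.dist_le_mul (z + s • v) z)
      rw [dist_eq_norm, add_sub_cancel_left, norm_smul, Real.norm_of_nonneg hs0.le] at h2
      simp
      linarith
    linarith
  refine ContinuousLinearMap.opNorm_le_bound _ L.2 fun v => ?_
  rw [Real.norm_eq_abs, abs_le]
  have h1 := key v
  have h2 := key (-v)
  rw [map_neg, norm_neg] at h2
  exact ⟨by linarith, h1⟩

end Charts

section Main

variable {E : Type*} [NormedAddCommGroup E] [NormedSpace ℝ E] [CompleteSpace E]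
  {M : Type*} [TopologicalSpace M] [ChartedSpace E M]
  {φ : OpenPartialHomeomorph M E} {ℓ : M → ℝ} {q : M}

/-- A lower bound on the weak lower Dini derivatives gives uniform growth along `V`. -/
theorem IsReflexiveSpace.growth_of_le_weakLowerDini (hE : IsReflexiveSpace E)
    (hφ : IsChartAround φ q) {V : Set (TangentSpace 𝓘(ℝ, E) q)} (hVclosed : IsClosed V)
    (hVbdd : Bornology.IsVonNBounded ℝ V) (hVconv : Convex ℝ V) {r : ℝ}
    (hr : ∀ v ∈ V, (r : EReal) ≤ weakLowerDini φ ℓ q V v) {r₁ : ℝ} (hr₁ : r₁ < r) :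
    ∃ T₀ > 0, ∀ T, 0 < T → T < T₀ → ∀ v ∈ V,
      T * r₁ ≤ ℓ (φ.symm (φ q + T • mvfderiv 𝓘(ℝ, E) φ q v)) - ℓ q := by
  by_contra! hcon
  obtain ⟨A, hA⟩ := hφ.isInvertible_mvfderiv
  choose t ht0 htn v hv hlt using fun n : ℕ => hcon (1 / ((n : ℝ) + 1)) (by positivity)
  have hbdd : Bornology.IsBounded (A '' V) :=
    NormedSpace.isVonNBounded_iff ℝ |>.1 (hVbdd.image (A : _ →L[ℝ] E))
  obtain ⟨R, hR⟩ := hbdd.exists_norm_le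
  obtain ⟨w, κ, hκ, hw⟩ := hE.exists_subseq_tendsto_weakly (v := fun n => A (v n)) (R := R)
    fun n => hR _ ⟨v n, hv n, rfl⟩
  have hwA : w ∈ A '' V := by
    by_contra hnot
    have hcl : IsClosed (A '' V) := A.toHomeomorph.isClosedMap _ hVclosed
    have hcv : Convex ℝ (A '' V) := hVconv.linear_image (A : _ →ₗ[ℝ] E)
    obtain ⟨f, s, hs, hsw⟩ := geometric_hahn_banach_closed_point hcv hcl hnot
    exact absurd (le_of_tendsto' (hw f) fun n => (hs _ ⟨_, hv (κ n), rfl⟩).le) (not_le.2 hsw)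
  obtain ⟨v₀, hv₀, rfl⟩ := hwA
  obtain ⟨Q, κ', hκ', hQ⟩ := CompactSpace.tendsto_subseq fun n =>
    (((ℓ (φ.symm (φ q + t (κ n) • mvfderiv 𝓘(ℝ, E) φ q (v (κ n)))) - ℓ q) / t (κ n) : ℝ) : EReal)
  have ht : Tendsto t atTop (𝓝 0) :=
    squeeze_zero (fun n => (ht0 n).le) (fun n => (htn n).le) tendsto_one_div_add_atTop_nhds_zero_nat
  have hle : weakLowerDini φ ℓ q V v₀ ≤ Q := by
    refine sInf_le ⟨fun n => v (κ (κ' n)), fun n => t (κ (κ' n)), fun n => hv _, fun ξ => ?_,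
      fun n => ht0 _, (ht.comp hκ.tendsto_atTop).comp hκ'.tendsto_atTop, hQ⟩
    have := (hw (ξ.comp (A.symm : E →L[ℝ] _))).comp hκ'.tendsto_atTop
    simpa [Function.comp_def] using this
  have hQr : Q ≤ (r₁ : EReal) := by
    refine le_of_tendsto' hQ fun n => ?_
    simp only [Function.comp_apply, EReal.coe_le_coe_iff]
    rw [div_le_iff₀ (ht0 _), mul_comm]
    exact (hlt _).le
  exact absurd ((hr v₀ hv₀).trans (hle.trans hQr)) (not_le.2 (EReal.coe_lt_coe_iff.2 hr₁))

/-- Uniform growth along `V` gives approximate subgradients near `q`, in a chart. -/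
theorem IsReflexiveSpace.exists_approx_subgradient (hE : IsReflexiveSpace E) {ψ : E → ℝ}
    {L : NNReal} (hψ : LipschitzWith L ψ) {W : Set E} (hWc : IsClosed W) (hWconv : Convex ℝ W)
    (hWne : W.Nonempty) (hWb : Bornology.IsBounded W) {x₀ : E} {r : ℝ}
    (hgrow : ∀ r₁ < r, ∃ T₀ > 0, ∀ T, 0 < T → T < T₀ → ∀ w ∈ W,
      T * r₁ ≤ ψ (x₀ + T • w) - ψ x₀) {ε : ℝ} (hε : 0 < ε) :
    ∃ (h : E → ℝ) (z : E), ContDiff ℝ 1 h ∧ ‖z - x₀‖ < ε ∧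
      (∀ y, ψ z - h z ≤ ψ y - h y) ∧ ∀ w ∈ W, r - ε ≤ fderiv ℝ h z w := by
  obtain ⟨R, hR⟩ := hWb.exists_norm_le
  have hR0 : 0 ≤ R := (norm_nonneg _).trans (hR _ hWne.some_mem)
  obtain ⟨T₀, hT₀, hT⟩ := hgrow (r - ε / 4) (by linarith)
  set D := R + L * R + 1 + |r - ε / 2| with hD
  have hD0 : 0 < D := by positivity
  have hm : 0 < min T₀ (ε / D) := lt_min hT₀ (by positivity)
  have hlt : min T₀ (ε / D) / 2 < min T₀ (ε / D) := half_lt_self hm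
  obtain ⟨h, z, hh, hz, hmin, hd⟩ := hE.exists_multidirectional_mean_value hψ hWc hWconv hWne hR
    (half_pos hm) (show r - ε / 2 < r - ε / 4 by linarith)
    (hT _ (half_pos hm) (hlt.trans_le (min_le_left _ _))) (half_pos hε)
  refine ⟨h, z, hh, hz.trans_lt ?_, hmin, fun w hw => ?_⟩
  · exact (lt_div_iff₀ hD0).1 (hlt.trans_le (min_le_right _ _))
  · linarith [hd w hw]

theorem IsReflexiveSpace.exists_limitingSubdifferential_of_growth [T3Space M]
    (hE : IsReflexiveSpace E)
    (hℓ : IsLocallyLipschitzOnManifold (E := E) ℓ) (hφ : IsChartAround φ q)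
    {V : Set (TangentSpace 𝓘(ℝ, E) q)} (hVne : V.Nonempty) (hVclosed : IsClosed V)
    (hVbdd : Bornology.IsVonNBounded ℝ V) (hVconv : Convex ℝ V) {r : ℝ}
    (hgrow : ∀ r₁ < r, ∃ T₀ > 0, ∀ T, 0 < T → T < T₀ → ∀ v ∈ V,
      T * r₁ ≤ ℓ (φ.symm (φ q + T • mvfderiv 𝓘(ℝ, E) φ q v)) - ℓ q) :
    ∃ ζ ∈ limitingSubdifferential ℓ q, ∀ v ∈ V, r ≤ ζ v := by
  obtain ⟨A, hA⟩ := hφ.isInvertible_mvfderiv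
  have hAv : ∀ v, mvfderiv 𝓘(ℝ, E) φ q v = A v := fun v => by rw [← hA]; rfl
  have hWb : Bornology.IsBounded (A '' V) :=
    NormedSpace.isVonNBounded_iff ℝ |>.1 (hVbdd.image (A : _ →L[ℝ] E))
  have hWc : IsClosed (A '' V) := A.toHomeomorph.isClosedMap _ hVclosed
  have hWconv : Convex ℝ (A '' V) := hVconv.linear_image (A : _ →ₗ[ℝ] E)
  obtain ⟨R, hR⟩ := hWb.exists_norm_le
  obtain ⟨L, U, hU, hLip⟩ := hℓ.lipschitzOnWith_chart hφ
  obtain ⟨ψ, hψ, hψU⟩ := hLip.extend_real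
  obtain ⟨η, hη, hball⟩ := Metric.mem_nhds_iff.1
    (inter_mem hU (φ.open_target.mem_nhds (φ.map_source hφ.2)))
  have hψb : ∀ y ∈ Metric.ball (φ q) η, ψ y = ℓ (φ.symm y) := fun y hy =>
    (hψU (hball hy).1).symm
  have hψq : ψ (φ q) = ℓ q := by
    rw [hψb _ (Metric.mem_ball_self hη), φ.left_inv hφ.2]
  have hgrow' : ∀ r₁ < r, ∃ T₀ > 0, ∀ T, 0 < T → T < T₀ → ∀ w ∈ A '' V,
      T * r₁ ≤ ψ (φ q + T • w) - ψ (φ q) := by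
    intro r₁ hr₁
    obtain ⟨T₀, hT₀, hT⟩ := hgrow r₁ hr₁
    refine ⟨min T₀ (η / (|R| + 1)), by positivity, fun T hT0 hTlt => ?_⟩
    rintro _ ⟨v, hv, rfl⟩
    have h1 := hT T hT0 (hTlt.trans_le (min_le_left _ _)) v hv
    rw [hAv] at h1
    rw [hψq, hψb _ ?_]
    · exact h1
    · rw [mem_ball_iff_norm, add_sub_cancel_left, norm_smul, Real.norm_of_nonneg hT0.le]
      have h2 := (lt_div_iff₀ (by positivity)).1 (hTlt.trans_le (min_le_right _ _))
      have h3 : ‖A v‖ ≤ |R| + 1 := by linarith [hR _ ⟨v, hv, rfl⟩, le_abs_self R]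
      exact (mul_le_mul_of_nonneg_left h3 hT0.le).trans_lt h2
  choose h z hh hz hmin hd using fun k : ℕ => hE.exists_approx_subgradient hψ hWc hWconv
    (hVne.image A) hWb hgrow' (show 0 < min η (1 / ((k : ℝ) + 1)) by positivity)
  obtain ⟨ζ, κ, hκ, hζ⟩ := hE.exists_subseq_tendsto_dual (u := fun k => fderiv ℝ (h k) (z k))
    (R := L) fun k => norm_fderiv_le_of_touching hψ (hh k) (hmin k)
  have hzb : ∀ k, z k ∈ Metric.ball (φ q) η := fun k =>
    mem_ball_iff_norm.2 ((hz k).trans_le (min_le_left _ _))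
  have hzt : ∀ k, z k ∈ φ.target := fun k => (hball (hzb k)).2
  have hone : Tendsto (fun k : ℕ => 1 / ((k : ℝ) + 1)) atTop (𝓝 0) :=
    tendsto_one_div_add_atTop_nhds_zero_nat
  have hzlim : Tendsto z atTop (𝓝 (φ q)) := tendsto_iff_norm_sub_tendsto_zero.2
    (squeeze_zero (fun _ => norm_nonneg _) (fun k => (hz k).le.trans (min_le_right _ _)) hone)
  have hzκ : Tendsto (fun k => z (κ k)) atTop (𝓝 (φ q)) := hzlim.comp hκ.tendsto_atTop
  set p : ℕ → M := fun k => φ.symm (z (κ k)) with hp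
  have hφp : ∀ k, φ (p k) = z (κ k) := fun k => φ.right_inv (hzt _)
  have hchart : ∀ k, IsChartAround φ (p k) := fun k => ⟨hφ.1, φ.map_target (hzt _)⟩
  have hplim : Tendsto p atTop (𝓝 q) := by
    have := (φ.continuousAt_symm (φ.map_source hφ.2)).tendsto.comp hzκ
    rwa [φ.left_inv hφ.2] at this
  refine ⟨ζ.comp (mvfderiv 𝓘(ℝ, E) φ q), ⟨p, fun k => (fderiv ℝ (h (κ k)) (φ (p k))).comp
    (mvfderiv 𝓘(ℝ, E) φ (p k)), hplim, ?_, fun k => ?_, ?_⟩, fun v hv => ?_⟩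
  · rw [← hψq]
    refine ((hψ.continuous.tendsto (φ q)).comp hzκ).congr fun k => ?_
    exact hψb _ (hzb _)
  · refine hE.comp_mvfderiv_mem_frechetSubdifferential (hchart k) (hh _) ?_
    rw [hφp]
    filter_upwards [Metric.isOpen_ball.mem_nhds (hzb (κ k))] with y hy
    have := hmin (κ k) y
    rwa [hψb _ hy, hψb _ (hzb _)] at this
  · intro φ' hφ' w
    have hJ := hφ.contDiffAt_transition hφ'
    have hφ'p : Tendsto (fun k => φ' (p k)) atTop (𝓝 (φ' q)) :=
      (φ'.continuousAt hφ'.2).tendsto.comp hplim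
    have hJlim : Tendsto (fun k => fderiv ℝ (φ ∘ φ'.symm) (φ' (p k)) w) atTop
        (𝓝 (fderiv ℝ (φ ∘ φ'.symm) (φ' q) w)) :=
      ((ContinuousLinearMap.apply ℝ E w).continuous.tendsto _).comp
        ((hJ.continuousAt_fderiv one_ne_zero).tendsto.comp hφ'p)
    have hlim : Tendsto (fun k => fderiv ℝ (h (κ k)) (z (κ k))
        (fderiv ℝ (φ ∘ φ'.symm) (φ' (p k)) w)) atTop
        (𝓝 (ζ (fderiv ℝ (φ ∘ φ'.symm) (φ' q) w))) := by
      have h1 : Tendsto (fun k => fderiv ℝ (h (κ k)) (z (κ k))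
          (fderiv ℝ (φ ∘ φ'.symm) (φ' (p k)) w - fderiv ℝ (φ ∘ φ'.symm) (φ' q) w)) atTop (𝓝 0) := by
        refine squeeze_zero_norm (fun k => (ContinuousLinearMap.le_opNorm _ _).trans
          (mul_le_mul_of_nonneg_right (norm_fderiv_le_of_touching hψ (hh _) (hmin _))
            (norm_nonneg _))) ?_
        simpa using (tendsto_iff_norm_sub_tendsto_zero.1 hJlim).const_mul (L : ℝ)
      have h2 := h1.add (hζ (fderiv ℝ (φ ∘ φ'.symm) (φ' q) w))
      rw [zero_add] at h2
      refine h2.congr fun k => ?_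
      rw [map_sub, sub_add_cancel]
    have e : (ζ.comp (mvfderiv 𝓘(ℝ, E) φ q)) ((mvfderiv 𝓘(ℝ, E) φ' q).inverse w) =
        ζ (fderiv ℝ (φ ∘ φ'.symm) (φ' q) w) := by
      rw [ContinuousLinearMap.comp_apply, mvfderiv_inverse_eq_transition hφ hφ']
    rw [e]
    refine hlim.congr' ?_
    filter_upwards [hplim.eventually hφ'.eventually] with k hk
    rw [ContinuousLinearMap.comp_apply, mvfderiv_inverse_eq_transition (hchart k) hk, hφp]
  · have h1 : Tendsto (fun k => r - 1 / ((κ k : ℝ) + 1)) atTop (𝓝 r) := by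
      simpa using (tendsto_const_nhds (x := r)).sub (hone.comp hκ.tendsto_atTop)
    refine le_of_tendsto_of_tendsto' h1 (hζ (mvfderiv 𝓘(ℝ, E) φ q v)) fun k => ?_
    have h2 := hd (κ k) (A v) ⟨v, hv, rfl⟩
    have h3 := min_le_right η (1 / ((κ k : ℝ) + 1))
    rw [hAv]
    linarith

end Main

theorem mainTheorem3 {E : Type*} [NormedAddCommGroup E] [NormedSpace ℝ E] [CompleteSpace E]
    (hE : IsReflexiveSpace E)
    {M : Type*} [TopologicalSpace M] [T3Space M] [ChartedSpace E M] [IsManifold 𝓘(ℝ, E) 1 M]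
    (ℓ : M → ℝ) (hℓ : IsLocallyLipschitzOnManifold (E := E) ℓ) (q : M)
    (V : Set (TangentSpace 𝓘(ℝ, E) q))
    (hVclosed : IsClosed V) (hVbdd : Bornology.IsVonNBounded ℝ V) (hVconv : Convex ℝ V)
    (φ : OpenPartialHomeomorph M E) (hφ : IsChartAround φ q) (r : ℝ)
    (hr : ∀ v ∈ V, (r : EReal) ≤ weakLowerDini φ ℓ q V v) :
    ∃ ζ ∈ limitingSubdifferential ℓ q, ∀ v ∈ V, r ≤ ζ v := by
  rcases V.eq_empty_or_nonempty with rfl | hVne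
  · obtain ⟨A, hA⟩ := hφ.isInvertible_mvfderiv
    have : T1Space (TangentSpace 𝓘(ℝ, E) q) := A.toHomeomorph.symm.t1Space
    obtain ⟨ζ, hζ, -⟩ := hE.exists_limitingSubdifferential_of_growth hℓ hφ
      (V := {(0 : TangentSpace 𝓘(ℝ, E) q)}) (Set.singleton_nonempty 0) isClosed_singleton
      (Bornology.isVonNBounded_singleton 0) (convex_singleton 0) (r := 0) fun r₁ hr₁ => by
        refine ⟨1, one_pos, fun T hT _ v hv => ?_⟩
        rw [Set.mem_singleton_iff.1 hv, map_zero, smul_zero, add_zero, φ.left_inv hφ.2, sub_self]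
        exact mul_nonpos_of_nonneg_of_nonpos hT.le hr₁.le
    exact ⟨ζ, hζ, fun v hv => absurd hv (Set.notMem_empty v)⟩
  · exact hE.exists_limitingSubdifferential_of_growth hℓ hφ hVne hVclosed hVbdd hVconv
      fun r₁ hr₁ => hE.growth_of_le_weakLowerDini hφ hVclosed hVbdd hVconv hr hr₁
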